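/- Consider the semilinear $2\times 2$ hyperbolic system $$u_t=-\lambda^u(x)u_x+f^u(w,x),\quad v_t=\lambda^v(x)v_x+f^v(w,x),\quad u(0,t)=g(v(0,t),t),\quad v(1,t)=U(t),\quad w(\cdot,0)=w_0,$$ for $x\in[0,1]$, $t\ge 0$, $w=(u,v)$, in the sense of broad solutions (bounded on bounded time intervals and satisfying the integral equations along characteristics). Here $\lambda^u,\lambda^v$ are measurable and bounded between two positive constants, $f^u,f^v$ and $g$ are measurable in their last argument and globally Lipschitz in the state, uniformly in the last argument, $f^u(0,x)=f^v(0,x)=0$, $g(0,t)=0$, and $w_0\in L^\infty([0,1],\mathbb R^2)$ (represented by a bounded measurable function). Put $\tau^u(x)=\int_0^x d\xi/\lambda^u(\xi)$ and $\tau^v(x)=\int_x^1 d\xi/\lambda^v(\xi)$, and let $\varepsilon>0$. For a state $w(\cdot,t)$ let $\bar u(x,t)=u(x,t+\tau^v(x))$ be its prediction, obtained by solving the Cauchy problem with data $w(\cdot,t)$ (balance laws and boundary condition at $x=0$) on the determinate sets $\{t\le s\le t+\tau^v(x)\}$ for $u$ and $\{t\le s<t+\tau^v(x)\}$ for $v$.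 The prediction of $v(0,t+\tau^v(0))$ under an input value $V$ is $z(0)$, where $z'=-f^v((\bar u(x,t),z),x)/\lambda^v(x)$ on $[0,1]$, $z(1)=V$. The target input at time $t$ is $z(1)$, where $z$ solves the same ODE with $z(0)=0$. The event-triggered algorithm starts at $t_0=0$ with an input value $\bar U_0\in\mathbb R$. Given $t_k$ and $\bar U_k$, it holds $U=\bar U_k$ on $[t_k,t_{k+1})$, where $t_{k+1}\in[t_k,\infty]$ is the infimum of the times $r\ge t_k$ at which, if the input is held at $\bar U_k$ from $t_k$ on, the prediction of $v(0,r+\tau^v(0))$ under $\bar U_k$ exceeds $\varepsilon$ in absolute value. If $t_{k+1}<\infty$, then $\bar U_{k+1}$ is the target input at time $t_{k+1}$. (i) There is a constant $c_2>0$, depending only on the model data $(\lambda^u,\lambda^v,f^u,f^v,g)$, such that every trajectory of the closed loop on $[0,\infty)$ satisfies $|v(0,t)|\le\varepsilon$ for all $t\ge\tau^v(0)$ and $\|w(\cdot,t)\|_\infty\le c_2\varepsilon$ for all $t\ge\tau^v(0)+\tau^u(1)$. (ii) For every $M$ there is $\Delta>0$, depending only on $\varepsilon$, $M$ and the model data,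 such that for every $w_0$ with $\|w_0\|_\infty\le M$, every $T\in(0,\infty]$ and every trajectory of the closed loop on $[0,T)$ one has $t_{k+1}-t_k\ge\Delta$ for all $k\ge1$ with $t_k<T$, and also for $k=0$ if $\bar U_0$ is the target input at time $0$. In particular, there is no Zeno behaviour. -/

import Mathlib

open MeasureTheory Set
open scoped NNReal

noncomputable section

/-- Data of the semilinear `2 × 2` hyperbolic system
`u_t = -λᵘ(x) u_x + fᵘ(w, x)`, `v_t = λᵛ(x) v_x + fᵛ(w, x)`, `u(0,t) = g(v(0,t), t)`,
`w = (u, v)`, together with the standing assumptions. Points of `ℝ × ℝ` carry the maximum norm;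
only the values for `x ∈ [0,1]` and `t ≥ 0` matter. -/
structure HypModel where
  lamU : ℝ → ℝ
  lamV : ℝ → ℝ
  fU : ℝ × ℝ → ℝ → ℝ
  fV : ℝ × ℝ → ℝ → ℝ
  g : ℝ → ℝ → ℝ
  measurable_lamU : Measurable lamU
  measurable_lamV : Measurable lamV
  measurable_fU : ∀ a, Measurable (fU a)
  measurable_fV : ∀ a, Measurable (fV a)
  measurable_g : ∀ a, Measurable (g a)
  speeds_lower : ∃ c : ℝ, 0 < c ∧ ∀ x ∈ Icc (0 : ℝ) 1, c ≤ lamU x ∧ c ≤ lamV x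
  speeds_upper : ∃ C : ℝ, ∀ x ∈ Icc (0 : ℝ) 1, lamU x ≤ C ∧ lamV x ≤ C
  lipschitz_f : ∃ l : ℝ≥0, ∀ x ∈ Icc (0 : ℝ) 1,
    LipschitzWith l (fun a => fU a x) ∧ LipschitzWith l (fun a => fV a x)
  lipschitz_g : ∃ l : ℝ≥0, ∀ t : ℝ, 0 ≤ t → LipschitzWith l (fun a => g a t)
  fU_zero : ∀ x ∈ Icc (0 : ℝ) 1, fU 0 x = 0
  fV_zero : ∀ x ∈ Icc (0 : ℝ) 1, fV 0 x = 0
  g_zero : ∀ t : ℝ, 0 ≤ t → g 0 t = 0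

namespace HypModel

variable (P : HypModel)

/-- `τᵘ(x)`: travel time of `u` from `0` to `x`. -/
def tauU (x : ℝ) : ℝ := ∫ ξ in (0 : ℝ)..x, 1 / P.lamU ξ

/-- `τᵛ(x)`: travel time of `v` from `1` to `x`. -/
def tauV (x : ℝ) : ℝ := ∫ ξ in x..(1 : ℝ), 1 / P.lamV ξ

/-- The determinate set of `u` at time `t`. -/
def detU (t : ℝ) : Set (ℝ × ℝ) :=
  {p | p.1 ∈ Icc (0 : ℝ) 1 ∧ t ≤ p.2 ∧ p.2 ≤ t + P.tauV p.1}

/-- The determinate set of `v` at time `t`. -/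
def detV (t : ℝ) : Set (ℝ × ℝ) :=
  {p | p.1 ∈ Icc (0 : ℝ) 1 ∧ t ≤ p.2 ∧ p.2 < t + P.tauV p.1}

/-- The space-time rectangle `[0,1] × [a,b]`. -/
def strip (a b : ℝ) : Set (ℝ × ℝ) := Icc (0 : ℝ) 1 ×ˢ Icc a b

/-- Broad solution `w = (u, v)`, with `u` considered on `Du` and `v` on `Dv`, of the two balance
laws with the boundary condition at `x = 0` and the state `w₀` at time `t₀`.

The balance laws are integrated along characteristics. The `u`-characteristic through `(x,t)`
consists of the points `(ξ, t - (τᵘ(x) - τᵘ(ξ)))`, the `v`-characteristic through `(x,t)` of the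
points `(ξ, t - (τᵛ(x) - τᵛ(ξ)))`; the position `ξ` is used as the parameter of integration.
At the corners `(0,t₀)` and `(1,t₀)` the incoming component takes the boundary value and not the
initial value. The values of `w` outside of the domains are irrelevant. -/
structure IsBroadSolution (Du Dv : Set (ℝ × ℝ)) (t₀ : ℝ) (w₀ : ℝ → ℝ × ℝ)
    (w : ℝ → ℝ → ℝ × ℝ) : Prop where
  measurable : Measurable (fun p : ℝ × ℝ => w p.1 p.2)
  bounded_u : ∃ C : ℝ, ∀ p ∈ Du, |(w p.1 p.2).1| ≤ C
  bounded_v : ∃ C : ℝ, ∀ p ∈ Dv, |(w p.1 p.2).2| ≤ C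
  u_eq : ∀ x y t : ℝ, y ≤ x → (x, t) ∈ Du → (y, t - (P.tauU x - P.tauU y)) ∈ Du →
    (w x t).1 = (w y (t - (P.tauU x - P.tauU y))).1
      + ∫ ξ in y..x, P.fU (w ξ (t - (P.tauU x - P.tauU ξ))) ξ / P.lamU ξ
  v_eq : ∀ x y t : ℝ, x ≤ y → (x, t) ∈ Dv → (y, t - (P.tauV x - P.tauV y)) ∈ Dv →
    (w x t).2 = (w y (t - (P.tauV x - P.tauV y))).2
      + ∫ ξ in x..y, P.fV (w ξ (t - (P.tauV x - P.tauV ξ))) ξ / P.lamV ξ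
  u_bc : ∀ t : ℝ, (0, t) ∈ Du → (0, t) ∈ Dv → (w 0 t).1 = P.g (w 0 t).2 t
  u_init : ∀ x ∈ Ioc (0 : ℝ) 1, (w x t₀).1 = (w₀ x).1
  v_init : ∀ x ∈ Ico (0 : ℝ) 1, (w x t₀).2 = (w₀ x).2

/-- `ubar(x) = u(x, t + τᵛ(x))`, predicted at time `t` from the measured state `wt` by solving the
Cauchy problem on the determinate sets. -/
def IsPredictedUbar (t : ℝ) (wt : ℝ → ℝ × ℝ) (ubar : ℝ → ℝ) : Prop :=
  ∃ w : ℝ → ℝ → ℝ × ℝ, P.IsBroadSolution (P.detU t) (P.detV t) t wt w ∧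
    ∀ x ∈ Icc (0 : ℝ) 1, ubar x = (w x (t + P.tauV x)).1

/-- Carathéodory solution on `[0,1]` of `z'(x) = -fᵛ((ubar(x), z(x)), x) / λᵛ(x)`. -/
def IsVbarSolution (ubar z : ℝ → ℝ) : Prop :=
  ContinuousOn z (Icc 0 1) ∧
    ∀ x ∈ Icc (0 : ℝ) 1, ∀ y ∈ Icc (0 : ℝ) 1,
      z y = z x - ∫ ξ in x..y, P.fV (ubar ξ, z ξ) ξ / P.lamV ξ

/-- `p` is the prediction, made at time `t` from the state `wt`, of `v(0, t + τᵛ(0))` under the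
input value `V`. -/
def Predicts (t : ℝ) (wt : ℝ → ℝ × ℝ) (V p : ℝ) : Prop :=
  ∃ ubar z : ℝ → ℝ, P.IsPredictedUbar t wt ubar ∧ P.IsVbarSolution ubar z ∧ z 1 = V ∧ z 0 = p

/-- `V` is the input value obtained at time `t` from the state `wt` by solving the target dynamics
with value `0` at `x = 0`. -/
def IsTargetInput (t : ℝ) (wt : ℝ → ℝ × ℝ) (V : ℝ) : Prop :=
  ∃ ubar z : ℝ → ℝ, P.IsPredictedUbar t wt ubar ∧ P.IsVbarSolution ubar z ∧ z 0 = 0 ∧ z 1 = V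

/-- The times `r ≥ a` at which the trigger condition holds if the system starts in the state `wa`
at time `a` and the input is held at the value `V` from time `a` on up to time `r`. -/
def triggerTimes (ε a : ℝ) (wa : ℝ → ℝ × ℝ) (V : ℝ) : Set ℝ :=
  {r | a ≤ r ∧ ∃ (h : ℝ → ℝ → ℝ × ℝ) (p : ℝ),
    P.IsBroadSolution (strip a r) (strip a r) a wa h ∧ (∀ s ∈ Icc a r, (h 1 s).2 = V) ∧
    P.Predicts r (fun x => h x r) V p ∧ ε < |p|}

/-- `w` is a trajectory on the time interval `[0,T)`, `T ≤ ∞`, of the system in closed loop with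
the event-triggered algorithm with threshold `ε`. The input `U` has the value `Ubar k` on
`[t k, t (k+1))`. The initial input value `Ubar 0` is arbitrary. The next update time is the
infimum of the times at which the trigger condition holds while the input is held; `t (k+1) = ⊤`
means that there is no such update. Nothing is required after an accumulation point of the update
times. -/
structure IsClosedLoop (T : EReal) (ε : ℝ) (w₀ : ℝ → ℝ × ℝ) (t : ℕ → EReal) (Ubar : ℕ → ℝ)
    (U : ℝ → ℝ) (w : ℝ → ℝ → ℝ × ℝ) : Prop where
  solution : ∀ b : ℝ, 0 ≤ b → (b : EReal) < T →
    P.IsBroadSolution (strip 0 b) (strip 0 b) 0 w₀ w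
  v_bc : ∀ s : ℝ, 0 ≤ s → (s : EReal) < T → (w 1 s).2 = U s
  hold : ∀ (k : ℕ) (s : ℝ), t k ≤ (s : EReal) → (s : EReal) < t (k + 1) → (s : EReal) < T →
    U s = Ubar k
  first : t 0 = 0
  next : ∀ (k : ℕ) (a : ℝ), t k = (a : EReal) → (a : EReal) < T →
    t (k + 1) = sInf ((fun r : ℝ => (r : EReal)) '' P.triggerTimes ε a (fun x => w x a) (Ubar k))
  terminate : ∀ k : ℕ, T ≤ t k → t (k + 1) = ⊤
  update : ∀ (k : ℕ) (a : ℝ), t (k + 1) = (a : EReal) → (a : EReal) < T →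
    P.IsTargetInput a (fun x => w x a) (Ubar (k + 1))

end HypModel

end

/-!
The proof needs no existence theory for the Cauchy problem: whenever a prediction or an update of
the input occurs, a solution on the determinate sets is given, and it continues the trajectory
(`HypModel.IsBound.glue`).

A solution that reaches far enough is its own prediction. Hence, as long as the trigger condition
has not held, `|v(0, r + τᵛ(0))| ≤ ε` (`HypModel.IsClosedLoop.abs_predicted_le`). With the position
as evolution variable, the boundary values `v(0,·)`, and `u(0,·) = g(v(0,·),·)`, bound the state at
all positions (`HypModel.IsBound.space_evolution`). This proves (i), once the update times are known
to tend to infinity, and it also bounds the state at all update times in terms of `ε` and `M`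
(`HypModel.IsClosedLoop.state_bound`).

For the dwell time (`HypModel.IsBound.exists_dwell`), the prediction is `0` at an update time `a`,
and it has to be shown that it moves continuously in time, with a modulus depending only on the
bound of the state. The predicted values of `u` on the `v`-characteristics through `(1,a)` and
through `(1,r)` are not close to each other at the same position, however small `r - a` is, since
`u` is merely bounded. They are close where the two characteristics meet the same
`u`-characteristic. If the label `τᵘ - τᵛ` of the crossing `u`-characteristic is used as variable of
integration, they are approximately translates of each other, and a translation of the integral
moves the difference to the coefficients of the model. These are fixed functions of the position, so
the continuity of translations in `L¹` applies, uniformly over bounded states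
(`exists_translate_majorant`, `HypModel.IsBound.exists_shift_bound`).

Solutions are bounded and compared by means of exponential weights: `weighted_sup_bound` plays the
role of Grönwall's inequality for suprema that need not be measurable.
-/

noncomputable section

/-! ### Self-improving bounds and exponentially weighted integrals -/

/-- Two functions that are bounded relative to a weight `ω`, and whose every common relative bound
`m` improves to `A + m / 2`, are bounded by `2 A ω`. This replaces Grönwall's inequality for
quantities that need not be measurable. -/
theorem weighted_sup_bound {α : Type*} {S T : Set α} {φ ψ ω : α → ℝ} {A : ℝ}
    (hω : ∀ p, 0 ≤ ω p)
    (hbd : ∃ m, (∀ p ∈ S, φ p ≤ m * ω p) ∧ ∀ p ∈ T, ψ p ≤ m * ω p)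
    (step : ∀ m, 0 ≤ m → (∀ p ∈ S, φ p ≤ m * ω p) → (∀ p ∈ T, ψ p ≤ m * ω p) →
      (∀ p ∈ S, φ p ≤ (A + m / 2) * ω p) ∧ ∀ p ∈ T, ψ p ≤ (A + m / 2) * ω p)
    (hA : 0 ≤ A) :
    (∀ p ∈ S, φ p ≤ 2 * A * ω p) ∧ ∀ p ∈ T, ψ p ≤ 2 * A * ω p := by
  set Q : Set ℝ := {m | 0 ≤ m ∧ (∀ p ∈ S, φ p ≤ m * ω p) ∧ ∀ p ∈ T, ψ p ≤ m * ω p} with hQ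
  have hne : Q.Nonempty := by
    obtain ⟨m, h1, h2⟩ := hbd
    exact ⟨max m 0, le_max_right _ _,
      fun p hp => (h1 p hp).trans (mul_le_mul_of_nonneg_right (le_max_left _ _) (hω p)),
      fun p hp => (h2 p hp).trans (mul_le_mul_of_nonneg_right (le_max_left _ _) (hω p))⟩
  have hbb : BddBelow Q := ⟨0, fun m hm => hm.1⟩
  have hcl : IsClosed Q := by
    simp only [hQ, ofPred_and, ofPred_forall]
    refine (isClosed_le continuous_const continuous_id).inter (IsClosed.inter ?_ ?_)
    · exact isClosed_iInter fun p => isClosed_iInter fun _ =>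
        isClosed_le continuous_const (continuous_id.mul continuous_const)
    · exact isClosed_iInter fun p => isClosed_iInter fun _ =>
        isClosed_le continuous_const (continuous_id.mul continuous_const)
  have hmem : sInf Q ∈ Q := hcl.csInf_mem hne hbb
  obtain ⟨s1, s2⟩ := step _ hmem.1 hmem.2.1 hmem.2.2
  have h3 : sInf Q ≤ A + sInf Q / 2 :=
    csInf_le hbb ⟨by have := hmem.1; positivity, s1, s2⟩
  have h4 : sInf Q ≤ 2 * A := by linarith
  exact ⟨fun p hp => (hmem.2.1 p hp).trans (mul_le_mul_of_nonneg_right h4 (hω p)),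
    fun p hp => (hmem.2.2 p hp).trans (mul_le_mul_of_nonneg_right h4 (hω p))⟩

/-- The values at the two end points do not matter for a bound of an interval integral. -/
theorem abs_integral_le_of_Ioo {F g : ℝ → ℝ} {y x : ℝ} (hyx : y ≤ x)
    (h : ∀ ξ ∈ Ioo y x, |F ξ| ≤ g ξ) (hg : IntervalIntegrable g volume y x) :
    |∫ ξ in y..x, F ξ| ≤ ∫ ξ in y..x, g ξ := by
  refine intervalIntegral.norm_integral_le_of_norm_le (μ := volume) (f := F) hyx ?_ hg
  filter_upwards [compl_mem_ae_iff.2 (measure_singleton x)] with ξ hξ hm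
  exact h ξ ⟨hm.1, lt_of_le_of_ne hm.2 hξ⟩

theorem abs_integral_le_const {F : ℝ → ℝ} {y x B : ℝ} (hyx : y ≤ x)
    (h : ∀ ξ ∈ Ioo y x, |F ξ| ≤ B) : |∫ ξ in y..x, F ξ| ≤ B * (x - y) := by
  refine (abs_integral_le_of_Ioo hyx h intervalIntegrable_const).trans (le_of_eq ?_)
  simp [mul_comm]

theorem abs_integral_le_exp_left {F : ℝ → ℝ} {y x B k : ℝ} (hk : 0 < k) (hB : 0 ≤ B) (hyx : y ≤ x)
    (h : ∀ ξ ∈ Ioo y x, |F ξ| ≤ B * Real.exp (-(k * (x - ξ)))) :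
    |∫ ξ in y..x, F ξ| ≤ B / k := by
  have hc : Continuous fun ξ : ℝ => B * Real.exp (-(k * (x - ξ))) := by fun_prop
  refine (abs_integral_le_of_Ioo hyx h (hc.intervalIntegrable _ _)).trans ?_
  have hd : ∀ ξ ∈ uIcc y x, HasDerivAt (fun ξ : ℝ => B / k * Real.exp (-(k * (x - ξ))))
      (B * Real.exp (-(k * (x - ξ)))) ξ := by
    intro ξ _
    have h1 : HasDerivAt (fun ξ : ℝ => -(k * (x - ξ))) k ξ := by
      have := (((hasDerivAt_id ξ).const_sub x).const_mul k).fun_neg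
      simpa using this
    have h2 := h1.exp.const_mul (B / k)
    have h3 : B * Real.exp (-(k * (x - ξ))) = B / k * (Real.exp (-(k * (x - ξ))) * k) := by
      field_simp
    rw [h3]
    exact h2
  rw [intervalIntegral.integral_eq_sub_of_hasDerivAt hd (hc.intervalIntegrable _ _)]
  have : 0 ≤ B / k * Real.exp (-(k * (x - y))) := by positivity
  simpa using this

theorem abs_integral_le_exp_right {F : ℝ → ℝ} {y x B k : ℝ} (hk : 0 < k) (hB : 0 ≤ B)
    (hyx : y ≤ x) (h : ∀ ξ ∈ Ioo y x, |F ξ| ≤ B * Real.exp (-(k * (ξ - y)))) :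
    |∫ ξ in y..x, F ξ| ≤ B / k := by
  have := abs_integral_le_exp_left (F := fun ξ => F (-ξ)) (y := -x) (x := -y) hk hB (by linarith)
    (fun ξ hξ => by
      have := h (-ξ) ⟨by linarith [hξ.2], by linarith [hξ.1]⟩
      convert this using 4
      ring)
  simpa using this

/-! ### Continuity of translations in `L¹`, uniformly over a family -/

theorem exists_integral_translate_le {F : ℝ → ℝ} (hF : Integrable F) {η : ℝ} (hη : 0 < η) :
    ∃ Δ > 0, ∀ δ, 0 ≤ δ → δ ≤ Δ → Integrable (fun σ => |F (σ - δ) - F σ|) ∧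
      ∫ σ, |F (σ - δ) - F σ| ≤ η := by
  have hint : ∀ δ : ℝ, Integrable fun σ => F (σ - δ) := fun δ => hF.comp_sub_right δ
  obtain ⟨g, hgc, hFg, hg, hgi⟩ := hF.exists_hasCompactSupport_integral_sub_le
    (show (0 : ℝ) < η / 3 by positivity)
  obtain ⟨R, hR0, hR⟩ : ∃ R : ℝ, 0 < R ∧ ∀ σ, R < |σ| → g σ = 0 := by
    obtain ⟨R, hR0, hR⟩ := hgc.isCompact.isBounded.exists_pos_norm_le
    refine ⟨R, hR0, fun σ hσ => image_eq_zero_of_notMem_tsupport fun hm => ?_⟩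
    exact absurd (hR σ hm) (not_le.2 hσ)
  have huc := hgc.uniformContinuous_of_continuous hg
  obtain ⟨Δ, hΔ, hu⟩ := Metric.uniformContinuous_iff.1 huc (η / 3 / (2 * (R + 1))) (by positivity)
  refine ⟨min (Δ / 2) 1, by positivity, fun δ h0 h1 => ⟨((hint δ).sub hF).abs, ?_⟩⟩
  have hδΔ : δ < Δ := by linarith [h1.trans (min_le_left _ _)]
  have hδ1 : δ ≤ 1 := h1.trans (min_le_right _ _)
  have hFg' : ∫ σ, |F (σ - δ) - g (σ - δ)| ≤ η / 3 := by
    rw [integral_sub_right_eq_self (fun σ => |F σ - g σ|) δ]; exact hFg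
  have hgg : ∫ σ, |g (σ - δ) - g σ| ≤ η / 3 := by
    have hi : Integrable ((Icc (-(R + 1)) (R + 1)).indicator
        fun _ => η / 3 / (2 * (R + 1))) :=
      (integrable_indicator_iff measurableSet_Icc).2 (integrableOn_const (by simp))
    calc ∫ σ, |g (σ - δ) - g σ|
        ≤ ∫ σ, (Icc (-(R + 1)) (R + 1)).indicator (fun _ => η / 3 / (2 * (R + 1))) σ := by
          refine integral_mono ((hgi.comp_sub_right δ).sub hgi).abs hi fun σ => ?_
          by_cases hσ : σ ∈ Icc (-(R + 1)) (R + 1)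
          · rw [indicator_of_mem hσ]
            refine (hu ?_).le
            rw [Real.dist_eq, sub_sub_cancel_left, abs_neg, abs_of_nonneg h0]
            exact hδΔ
          · rw [indicator_of_notMem hσ]
            have hσ' : R + 1 < |σ| := by
              by_contra hc
              exact hσ (abs_le.1 (not_lt.1 hc))
            have h2 : R < |σ - δ| := by
              have := abs_sub_abs_le_abs_sub σ δ
              rw [abs_of_nonneg h0] at this
              linarith
            simp [hR _ h2, hR σ (by linarith)]
      _ = η / 3 := by
          rw [integral_indicator measurableSet_Icc, setIntegral_const]
          rw [Measure.real, Real.volume_Icc, ENNReal.toReal_ofReal (by linarith), smul_eq_mul]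
          field_simp
          ring
  have hi1 : Integrable fun σ => |F (σ - δ) - g (σ - δ)| :=
    ((hint δ).sub (hgi.comp_sub_right δ)).abs
  have hi2 : Integrable fun σ => |g (σ - δ) - g σ| := ((hgi.comp_sub_right δ).sub hgi).abs
  have hi3 : Integrable fun σ => |F σ - g σ| := (hF.sub hgi).abs
  calc ∫ σ, |F (σ - δ) - F σ|
      ≤ ∫ σ, (|F (σ - δ) - g (σ - δ)| + |g (σ - δ) - g σ| + |F σ - g σ|) := by
        refine integral_mono ((hint δ).sub hF).abs ((hi1.fun_add hi2).fun_add hi3) fun σ => ?_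
        have := abs_sub_le (F (σ - δ)) (g (σ - δ)) (F σ)
        have h4 := abs_sub_le (g (σ - δ)) (g σ) (F σ)
        rw [abs_sub_comm (g σ)] at h4
        dsimp only
        linarith
    _ = (∫ σ, |F (σ - δ) - g (σ - δ)|) + (∫ σ, |g (σ - δ) - g σ|) + ∫ σ, |F σ - g σ| := by
        rw [integral_add (hi1.fun_add hi2) hi3, integral_add hi1 hi2]
    _ ≤ η := by
        have : ∫ σ, |F σ - g σ| ≤ η / 3 := hFg
        linarith

/-- For a family `G c` of integrable functions that is Lipschitz in the parameter `c` and supported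
in a fixed interval, translation by a small `δ` changes `G c`, simultaneously for all `c` in a
ball, by at most a function of small integral. The parameter may therefore be an arbitrary
(rough) function of the variable. -/
theorem exists_translate_majorant {G : ℝ × ℝ → ℝ → ℝ} {L R C η : ℝ} (hL : 0 ≤ L) (hR : 0 ≤ R)
    (hint : ∀ c, Integrable (G c)) (hlip : ∀ c d σ, |G c σ - G d σ| ≤ L * ‖c - d‖)
    (hsupp : ∀ c σ, σ ∉ Icc 0 R → G c σ = 0) (hη : 0 < η) :
    ∃ Δ > 0, ∀ δ, 0 ≤ δ → δ ≤ Δ → ∃ N : ℝ → ℝ, Integrable N ∧ ∫ σ, N σ ≤ η ∧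
      (∀ σ c, ‖c‖ ≤ C → |G c (σ - δ) - G c σ| ≤ N σ) := by
  set e : ℝ := η / 2 / (2 * (L + 1) * (R + 1)) with he
  have hepos : 0 < e := by positivity
  obtain ⟨s, -, hsf, hs⟩ := (isCompact_closedBall (0 : ℝ × ℝ) C).finite_cover_balls hepos
  set e' : ℝ := η / 2 / (hsf.toFinset.card + 1) with he'
  have he'pos : 0 < e' := by positivity
  have key : ∀ t : Finset (ℝ × ℝ), ∃ Δ > 0, ∀ δ, 0 ≤ δ → δ ≤ Δ → ∀ c ∈ t,
      Integrable (fun σ => |G c (σ - δ) - G c σ|) ∧ ∫ σ, |G c (σ - δ) - G c σ| ≤ e' := by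
    intro t
    induction t using Finset.induction_on with
    | empty => exact ⟨1, one_pos, by simp⟩
    | insert a t ha ih =>
      obtain ⟨Δ₁, h1, H1⟩ := ih
      obtain ⟨Δ₂, h2, H2⟩ := exists_integral_translate_le (hint a) he'pos
      refine ⟨min Δ₁ Δ₂, lt_min h1 h2, fun δ h0 hδ c hc => ?_⟩
      rcases Finset.mem_insert.1 hc with rfl | hc
      · exact H2 δ h0 (hδ.trans (min_le_right _ _))
      · exact H1 δ h0 (hδ.trans (min_le_left _ _)) c hc
  obtain ⟨Δ, hΔ, H⟩ := key hsf.toFinset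
  refine ⟨min Δ 1, by positivity, fun δ h0 hδ => ?_⟩
  have hδ1 : δ ≤ 1 := hδ.trans (min_le_right _ _)
  replace H := H δ h0 (hδ.trans (min_le_left _ _))
  have hi1 : Integrable ((Icc 0 (R + 1)).indicator fun _ : ℝ => 2 * L * e) :=
    (integrable_indicator_iff measurableSet_Icc).2 (integrableOn_const (by simp))
  have hi2 : Integrable fun σ => ∑ d ∈ hsf.toFinset, |G d (σ - δ) - G d σ| :=
    integrable_finsetSum _ fun c hc => (H c hc).1
  refine ⟨fun σ => (Icc 0 (R + 1)).indicator (fun _ : ℝ => 2 * L * e) σ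
    + ∑ d ∈ hsf.toFinset, |G d (σ - δ) - G d σ|, hi1.fun_add hi2, ?_, fun σ c hc => ?_⟩
  · rw [integral_add hi1 hi2, integral_finsetSum _ fun c hc => (H c hc).1,
      integral_indicator measurableSet_Icc, setIntegral_const, Measure.real, Real.volume_Icc,
      ENNReal.toReal_ofReal (by linarith), smul_eq_mul]
    have h1 : (R + 1 - 0) * (2 * L * e) ≤ η / 2 := by
      have : η / 2 = 2 * (L + 1) * (R + 1) * e := by rw [he]; field_simp
      rw [this]
      nlinarith [mul_nonneg (show 0 ≤ R + 1 by linarith) hepos.le]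
    have h2 : ∑ d ∈ hsf.toFinset, ∫ σ, |G d (σ - δ) - G d σ| ≤ η / 2 := by
      refine (Finset.sum_le_card_nsmul _ _ e' fun c hc => (H c hc).2).trans ?_
      rw [nsmul_eq_mul]
      have : η / 2 = (hsf.toFinset.card + 1) * e' := by rw [he']; field_simp
      rw [this]
      nlinarith
    linarith
  · have hsum : 0 ≤ ∑ d ∈ hsf.toFinset, |G d (σ - δ) - G d σ| :=
      Finset.sum_nonneg fun _ _ => abs_nonneg _
    dsimp only
    by_cases hσ : σ ∈ Icc 0 (R + 1)
    · rw [indicator_of_mem hσ]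
      obtain ⟨d, hd, hcd⟩ := mem_iUnion₂.1 (hs (mem_closedBall_zero_iff.2 hc))
      have h1 : |G d (σ - δ) - G d σ| ≤ ∑ d ∈ hsf.toFinset, |G d (σ - δ) - G d σ| :=
        Finset.single_le_sum (f := fun d => |G d (σ - δ) - G d σ|) (fun _ _ => abs_nonneg _)
          (hsf.mem_toFinset.2 hd)
      have hcd' : L * ‖c - d‖ ≤ L * e :=
        mul_le_mul_of_nonneg_left (by rw [← dist_eq_norm]; exact (Metric.mem_ball.1 hcd).le) hL
      have h2 := hlip c d (σ - δ)
      have h3 := hlip c d σ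
      have h4 := abs_sub_le (G c (σ - δ)) (G d (σ - δ)) (G c σ)
      have h5 := abs_sub_le (G d (σ - δ)) (G d σ) (G c σ)
      rw [abs_sub_comm (G d σ)] at h5
      linarith
    · rw [indicator_of_notMem hσ, hsupp c σ, hsupp c (σ - δ)]
      · simpa using hsum
      · intro h
        exact hσ ⟨by linarith [h.1], by linarith [h.2]⟩
      · intro h
        exact hσ ⟨h.1, by linarith [h.2]⟩

/-! ### Change of variables with a bounded measurable density -/

/-- For a measurable density `κ` between two positive constants, the primitive `x ↦ ∫₀ˣ κ` has a
Lipschitz inverse `X`, and substituting `X` turns Lebesgue measure into the measure with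
density `κ`. -/
theorem exists_inverse_of_density {κ : ℝ → ℝ} {m M : ℝ} (hκ : Measurable κ) (hm : 0 < m)
    (hmκ : ∀ x, m ≤ κ x) (hκM : ∀ x, κ x ≤ M) :
    ∃ X : ℝ → ℝ, (∀ x, X (∫ ξ in (0 : ℝ)..x, κ ξ) = x) ∧
      (∀ σ, ∫ ξ in (0 : ℝ)..(X σ), κ ξ = σ) ∧ StrictMono X ∧
      (∀ σ τ, σ ≤ τ → X τ - X σ ≤ (τ - σ) / m) ∧
      (∀ F : ℝ → ℝ, Integrable (fun σ => F (X σ)) ↔ Integrable (fun ξ => κ ξ * F ξ)) ∧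
      ∀ F : ℝ → ℝ, ∫ σ, F (X σ) = ∫ ξ, κ ξ * F ξ := by
  have hii : ∀ a b, IntervalIntegrable κ volume a b := fun a b =>
    (intervalIntegrable_const (c := M)).mono_fun hκ.aestronglyMeasurable
      (Filter.Eventually.of_forall fun x => by
        have h1 := hmκ x
        have h2 := hκM x
        have h3 : ‖κ x‖ ≤ ‖M‖ := by
          rw [Real.norm_of_nonneg (by linarith)]
          exact h2.trans (le_abs_self M)
        exact h3)
  set ρ : ℝ → ℝ := fun x => ∫ ξ in (0 : ℝ)..x, κ ξ with hρ
  have hsub : ∀ x y, ρ y - ρ x = ∫ ξ in x..y, κ ξ := fun x y =>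
    intervalIntegral.integral_interval_sub_left (hii _ _) (hii _ _)
  have hlow : ∀ x y, x ≤ y → m * (y - x) ≤ ρ y - ρ x := by
    intro x y hxy
    rw [hsub]
    have := intervalIntegral.integral_mono_on hxy (intervalIntegrable_const (c := m)) (hii x y)
      fun z _ => hmκ z
    simpa [mul_comm] using this
  have hmono : StrictMono ρ := by
    intro x y hxy
    have := hlow x y hxy.le
    have : 0 < m * (y - x) := mul_pos hm (sub_pos.2 hxy)
    linarith
  have hcont : Continuous ρ := intervalIntegral.continuous_primitive hii 0
  have hρ0 : ρ 0 = 0 := by simp [hρ]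
  have hsurj : Function.Surjective ρ := by
    refine hcont.surjective ?_ ?_
    · refine Filter.tendsto_atTop_mono' _ ?_ (Filter.tendsto_id.const_mul_atTop hm)
      filter_upwards [Filter.eventually_ge_atTop 0] with x hx
      have := hlow 0 x hx
      simp only [id]; linarith
    · refine Filter.tendsto_atBot_mono' _ ?_ (Filter.tendsto_id.const_mul_atBot hm)
      filter_upwards [Filter.eventually_le_atBot 0] with x hx
      have := hlow x 0 hx
      simp only [id]; linarith
  set e : ℝ ≃o ℝ := hmono.orderIsoOfSurjective ρ hsurj with he
  have heρ : ∀ x, e x = ρ x := fun x => rfl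
  set k : ℝ → ℝ≥0 := fun x => (κ x).toNNReal with hk
  have hkm : Measurable k := hκ.real_toNNReal
  have hkκ : ∀ x, (k x : ℝ) = κ x := fun x => Real.coe_toNNReal _ (by linarith [hmκ x])
  have hmap : Measure.map e.toHomeomorph.toMeasurableEquiv
      (volume.withDensity fun x => (k x : ENNReal)) = volume := by
    refine (Real.measure_ext_Ioo_rat fun p q => ?_).symm
    rw [MeasurableEquiv.map_apply]
    have hpre : e.toHomeomorph.toMeasurableEquiv ⁻¹' Ioo (p : ℝ) q = Ioo (e.symm p) (e.symm q) := by
      ext x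
      simp [OrderIso.lt_symm_apply, OrderIso.symm_apply_lt]
    rw [hpre, withDensity_apply _ measurableSet_Ioo, Real.volume_Ioo]
    rcases le_total (q : ℝ) p with hqp | hpq
    · rw [Ioo_eq_empty (not_lt.2 (e.symm.monotone hqp)), ENNReal.ofReal_of_nonpos (by linarith)]
      simp
    · have hle : e.symm p ≤ e.symm q := e.symm.monotone hpq
      have h1 : (q : ℝ) - p = ∫ ξ in (e.symm p)..(e.symm q), κ ξ := by
        rw [← hsub, ← heρ, ← heρ]; simp
      rw [h1, intervalIntegral.integral_of_le hle, integral_Ioc_eq_integral_Ioo,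
        ofReal_integral_eq_lintegral_ofReal]
      · rfl
      · exact ((intervalIntegrable_iff_integrableOn_Ioo_of_le hle).1 (hii _ _))
      · exact Filter.Eventually.of_forall fun x => by simpa using hm.le.trans (hmκ x)
  have hX : ∀ x, e.symm (ρ x) = x := fun x => by rw [← heρ]; simp
  have hρX : ∀ σ, ρ (e.symm σ) = σ := fun σ => by rw [← heρ]; simp
  refine ⟨e.symm, hX, hρX, e.symm.strictMono, fun σ τ h => ?_, fun F => ?_, fun F => ?_⟩
  · have := hlow _ _ (e.symm.monotone h)
    rw [hρX, hρX] at this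
    rw [le_div_iff₀ hm]
    linarith
  · conv_lhs => rw [← hmap]
    rw [integrable_map_equiv]
    have : (fun σ => F (e.symm σ)) ∘ ⇑e.toHomeomorph.toMeasurableEquiv = F := by
      ext x; simp
    rw [this, integrable_withDensity_iff_integrable_smul hkm]
    simp only [NNReal.smul_def, hkκ, smul_eq_mul]
  · conv_lhs => rw [← hmap]
    rw [integral_map_equiv]
    simp only [Homeomorph.toMeasurableEquiv_coe, OrderIso.coe_toHomeomorph,
      OrderIso.symm_apply_apply]
    rw [integral_withDensity_eq_integral_smul hkm]
    simp only [NNReal.smul_def, hkκ, smul_eq_mul]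

/-! ### Right-hand sides of Carathéodory type -/

/-- A function `f` of a state and a position, measurable in the position, Lipschitz with constant
`L` in the state for positions in `[0,1]`, and vanishing at the state `0`. -/
structure IsRate (L : ℝ) (f : ℝ × ℝ → ℝ → ℝ) : Prop where
  nonneg : 0 ≤ L
  measurable : ∀ a, Measurable (f a)
  sub_le : ∀ ξ ∈ Icc (0 : ℝ) 1, ∀ a b, |f a ξ - f b ξ| ≤ L * ‖a - b‖
  zero : ∀ ξ ∈ Icc (0 : ℝ) 1, f 0 ξ = 0

namespace IsRate

variable {L : ℝ} {f : ℝ × ℝ → ℝ → ℝ}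

theorem abs_le (hf : IsRate L f) {ξ : ℝ} (hξ : ξ ∈ Icc (0 : ℝ) 1) (a : ℝ × ℝ) :
    |f a ξ| ≤ L * ‖a‖ := by
  simpa [hf.zero ξ hξ] using hf.sub_le ξ hξ a 0

theorem aemeasurable_comp (hf : IsRate L f) {c : ℝ → ℝ × ℝ}
    (hc : AEMeasurable c (volume.restrict (Icc 0 1))) :
    AEMeasurable (fun ξ => f (c ξ) ξ) (volume.restrict (Icc 0 1)) := by
  set F : ℝ × ℝ → ℝ → ℝ := fun a => (Icc (0 : ℝ) 1).indicator (f a) with hF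
  have hFm : Measurable (Function.uncurry F) := by
    refine measurable_uncurry_of_continuous_of_measurable (fun ξ => ?_)
      fun a => (hf.measurable a).indicator measurableSet_Icc
    by_cases hξ : ξ ∈ Icc (0 : ℝ) 1
    · have : LipschitzWith ⟨L, hf.nonneg⟩ fun a => F a ξ := by
        refine LipschitzWith.of_dist_le_mul fun a b => ?_
        simp only [hF, indicator_of_mem hξ, dist_eq_norm]
        exact hf.sub_le ξ hξ a b
      exact this.continuous
    · simp only [hF, indicator_of_notMem hξ]
      exact continuous_const
  have h1 : AEMeasurable (fun ξ => F (c ξ) ξ) (volume.restrict (Icc 0 1)) :=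
    hFm.comp_aemeasurable (hc.prodMk aemeasurable_id)
  refine h1.congr ?_
  filter_upwards [ae_restrict_mem measurableSet_Icc] with ξ hξ
  simp only [hF, indicator_of_mem hξ]

theorem intervalIntegrable (hf : IsRate L f) {c : ℝ → ℝ × ℝ}
    (hc : AEMeasurable c (volume.restrict (Icc 0 1))) {y x C : ℝ} (hy : 0 ≤ y) (hyx : y ≤ x)
    (hx : x ≤ 1) (hC : ∀ ξ ∈ Ioo y x, ‖c ξ‖ ≤ C) :
    IntervalIntegrable (fun ξ => f (c ξ) ξ) volume y x := by
  rw [intervalIntegrable_iff_integrableOn_Ioo_of_le hyx]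
  have hsub : Ioo y x ⊆ Icc 0 1 := fun ξ hξ => ⟨hy.trans hξ.1.le, hξ.2.le.trans hx⟩
  refine Integrable.of_bound (C := L * C)
    ((hf.aemeasurable_comp hc).mono_measure
      (Measure.restrict_mono hsub le_rfl)).aestronglyMeasurable ?_
  filter_upwards [ae_restrict_mem measurableSet_Ioo] with ξ hξ
  exact (hf.abs_le (hsub hξ) _).trans (mul_le_mul_of_nonneg_left (hC ξ hξ) hf.nonneg)

end IsRate

namespace HypModel

variable {P : HypModel} {K : ℝ}

/-- `K ≥ 1` bounds the speeds and the inverse speeds on `[0,1]` and is a Lipschitz constant of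
`fᵘ`, `fᵛ` and `g`. -/
structure IsBound (P : HypModel) (K : ℝ) : Prop where
  one_le : 1 ≤ K
  invU : ∀ x ∈ Icc (0 : ℝ) 1, 1 / K ≤ 1 / P.lamU x ∧ 1 / P.lamU x ≤ K
  invV : ∀ x ∈ Icc (0 : ℝ) 1, 1 / K ≤ 1 / P.lamV x ∧ 1 / P.lamV x ≤ K
  fU_sub_le : ∀ x ∈ Icc (0 : ℝ) 1, ∀ a b, |P.fU a x - P.fU b x| ≤ K * ‖a - b‖
  fV_sub_le : ∀ x ∈ Icc (0 : ℝ) 1, ∀ a b, |P.fV a x - P.fV b x| ≤ K * ‖a - b‖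
  g_sub_le : ∀ t : ℝ, 0 ≤ t → ∀ a b, |P.g a t - P.g b t| ≤ K * |a - b|

theorem exists_isBound (P : HypModel) : ∃ K, P.IsBound K := by
  obtain ⟨c, hc, hc'⟩ := P.speeds_lower
  obtain ⟨C, hC⟩ := P.speeds_upper
  obtain ⟨l, hl⟩ := P.lipschitz_f
  obtain ⟨l', hl'⟩ := P.lipschitz_g
  have h1 : 0 < 1 / c := by positivity
  have h2 := abs_nonneg C
  have h3 := le_abs_self C
  have h4 : (0 : ℝ) ≤ l := l.2
  have h5 : (0 : ℝ) ≤ l' := l'.2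
  have hinv : ∀ s : ℝ, c ≤ s → s ≤ C →
      1 / (1 + 1 / c + |C| + l + l') ≤ 1 / s ∧ 1 / s ≤ 1 + 1 / c + |C| + l + l' := by
    intro s hs hs'
    have hs0 : 0 < s := hc.trans_le hs
    refine ⟨one_div_le_one_div_of_le hs0 (by linarith), ?_⟩
    have := one_div_le_one_div_of_le hc hs
    linarith
  refine ⟨1 + 1 / c + |C| + l + l', by linarith, fun x hx => hinv _ (hc' x hx).1 (hC x hx).1,
    fun x hx => hinv _ (hc' x hx).2 (hC x hx).2, fun x hx a b => ?_, fun x hx a b => ?_,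
    fun t ht a b => ?_⟩
  · have := (hl x hx).1.dist_le_mul a b
    rw [dist_eq_norm, dist_eq_norm] at this
    exact this.trans (mul_le_mul_of_nonneg_right (by linarith) (norm_nonneg _))
  · have := (hl x hx).2.dist_le_mul a b
    rw [dist_eq_norm, dist_eq_norm] at this
    exact this.trans (mul_le_mul_of_nonneg_right (by linarith) (norm_nonneg _))
  · have := (hl' t ht).dist_le_mul a b
    rw [Real.dist_eq, Real.dist_eq] at this
    exact this.trans (mul_le_mul_of_nonneg_right (by linarith) (abs_nonneg _))

/-- Rate of change of `u` along its characteristic, with respect to the position. -/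
def rhsU (P : HypModel) (a : ℝ × ℝ) (ξ : ℝ) : ℝ := P.fU a ξ / P.lamU ξ

/-- Rate of change of `v` along its characteristic, with respect to the position (up to sign). -/
def rhsV (P : HypModel) (a : ℝ × ℝ) (ξ : ℝ) : ℝ := P.fV a ξ / P.lamV ξ

namespace IsBound

theorem pos (h : P.IsBound K) : 0 < K := by linarith [h.one_le]

theorem rateU (h : P.IsBound K) : IsRate (K ^ 2) P.rhsU where
  nonneg := by positivity
  measurable a := (P.measurable_fU a).div P.measurable_lamU
  sub_le ξ hξ a b := by
    have h1 := h.invU ξ hξ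
    have h0 : 0 < 1 / K := one_div_pos.2 h.pos
    rw [rhsU, rhsU, ← sub_div, div_eq_mul_one_div, abs_mul, abs_of_nonneg (h0.le.trans h1.1)]
    calc |P.fU a ξ - P.fU b ξ| * (1 / P.lamU ξ) ≤ (K * ‖a - b‖) * K :=
          mul_le_mul (h.fU_sub_le ξ hξ a b) h1.2 (h0.le.trans h1.1)
            (mul_nonneg h.pos.le (norm_nonneg _))
      _ = K ^ 2 * ‖a - b‖ := by ring
  zero ξ hξ := by simp [rhsU, P.fU_zero ξ hξ]

theorem rateV (h : P.IsBound K) : IsRate (K ^ 2) P.rhsV where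
  nonneg := by positivity
  measurable a := (P.measurable_fV a).div P.measurable_lamV
  sub_le ξ hξ a b := by
    have h1 := h.invV ξ hξ
    have h0 : 0 < 1 / K := one_div_pos.2 h.pos
    rw [rhsV, rhsV, ← sub_div, div_eq_mul_one_div, abs_mul, abs_of_nonneg (h0.le.trans h1.1)]
    calc |P.fV a ξ - P.fV b ξ| * (1 / P.lamV ξ) ≤ (K * ‖a - b‖) * K :=
          mul_le_mul (h.fV_sub_le ξ hξ a b) h1.2 (h0.le.trans h1.1)
            (mul_nonneg h.pos.le (norm_nonneg _))
      _ = K ^ 2 * ‖a - b‖ := by ring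
  zero ξ hξ := by simp [rhsV, P.fV_zero ξ hξ]

theorem abs_g_le (h : P.IsBound K) {t : ℝ} (ht : 0 ≤ t) (a : ℝ) : |P.g a t| ≤ K * |a| := by
  simpa [P.g_zero t ht] using h.g_sub_le t ht a 0

/-! ### Travel times -/

theorem integrable_inv {lam : ℝ → ℝ} (hm : Measurable lam) {B : ℝ} (hK : 0 < B)
    (h : ∀ x ∈ Icc (0 : ℝ) 1, 1 / B ≤ 1 / lam x ∧ 1 / lam x ≤ B) :
    IntegrableOn (fun x => 1 / lam x) (Icc 0 1) := by
  refine Integrable.of_bound (C := B) (measurable_const.div hm).aestronglyMeasurable ?_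
  filter_upwards [ae_restrict_mem measurableSet_Icc] with ξ hξ
  have h0 : 0 < 1 / B := one_div_pos.2 hK
  rw [Real.norm_of_nonneg (h0.le.trans (h ξ hξ).1)]
  exact (h ξ hξ).2

theorem integral_inv_bounds {lam : ℝ → ℝ} (hm : Measurable lam) {B : ℝ} (hK : 0 < B)
    (h : ∀ x ∈ Icc (0 : ℝ) 1, 1 / B ≤ 1 / lam x ∧ 1 / lam x ≤ B) {y x : ℝ} (hy : 0 ≤ y)
    (hyx : y ≤ x) (hx : x ≤ 1) :
    IntervalIntegrable (fun x => 1 / lam x) volume y x ∧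
      (x - y) / B ≤ (∫ ξ in y..x, 1 / lam ξ) ∧ (∫ ξ in y..x, 1 / lam ξ) ≤ B * (x - y) := by
  have hsub : Icc y x ⊆ Icc 0 1 := Icc_subset_Icc hy hx
  have hi : IntervalIntegrable (fun x => 1 / lam x) volume y x :=
    (intervalIntegrable_iff_integrableOn_Icc_of_le hyx).2 ((integrable_inv hm hK h).mono_set hsub)
  refine ⟨hi, ?_, ?_⟩
  · have := intervalIntegral.integral_mono_on hyx (intervalIntegrable_const (c := 1 / B)) hi
      fun z hz => (h z (hsub hz)).1
    simpa [div_eq_mul_inv] using this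
  · have := intervalIntegral.integral_mono_on hyx hi (intervalIntegrable_const (c := B))
      fun z hz => (h z (hsub hz)).2
    simpa [mul_comm] using this

theorem tauU_sub (h : P.IsBound K) {y x : ℝ} (hy : 0 ≤ y) (hyx : y ≤ x) (hx : x ≤ 1) :
    (x - y) / K ≤ P.tauU x - P.tauU y ∧ P.tauU x - P.tauU y ≤ K * (x - y) := by
  have h1 := integral_inv_bounds P.measurable_lamU h.pos h.invU hy hyx hx
  have h2 := integral_inv_bounds P.measurable_lamU h.pos h.invU le_rfl hy (hyx.trans hx)
  have : P.tauU x - P.tauU y = ∫ ξ in y..x, 1 / P.lamU ξ := by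
    rw [tauU, tauU, ← intervalIntegral.integral_add_adjacent_intervals h2.1 h1.1]; ring
  rw [this]
  exact h1.2

theorem tauV_sub (h : P.IsBound K) {y x : ℝ} (hy : 0 ≤ y) (hyx : y ≤ x) (hx : x ≤ 1) :
    (x - y) / K ≤ P.tauV y - P.tauV x ∧ P.tauV y - P.tauV x ≤ K * (x - y) := by
  have h1 := integral_inv_bounds P.measurable_lamV h.pos h.invV hy hyx hx
  have h2 := integral_inv_bounds P.measurable_lamV h.pos h.invV (hy.trans hyx) hx le_rfl
  have : P.tauV y - P.tauV x = ∫ ξ in y..x, 1 / P.lamV ξ := by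
    rw [tauV, tauV, ← intervalIntegral.integral_add_adjacent_intervals h1.1 h2.1]; ring
  rw [this]
  exact h1.2

theorem tauU_zero : P.tauU 0 = 0 := by simp [tauU]

theorem tauV_one : P.tauV 1 = 0 := by simp [tauV]

theorem tauU_mono (h : P.IsBound K) {y x : ℝ} (hy : 0 ≤ y) (hyx : y ≤ x) (hx : x ≤ 1) :
    P.tauU y ≤ P.tauU x := by
  have := (h.tauU_sub hy hyx hx).1
  have : 0 ≤ (x - y) / K := div_nonneg (by linarith) h.pos.le
  linarith

theorem tauV_anti (h : P.IsBound K) {y x : ℝ} (hy : 0 ≤ y) (hyx : y ≤ x) (hx : x ≤ 1) :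
    P.tauV x ≤ P.tauV y := by
  have := (h.tauV_sub hy hyx hx).1
  have : 0 ≤ (x - y) / K := div_nonneg (by linarith) h.pos.le
  linarith

theorem tauU_strictMono (h : P.IsBound K) {y x : ℝ} (hy : 0 ≤ y) (hyx : y < x) (hx : x ≤ 1) :
    P.tauU y < P.tauU x := by
  have := (h.tauU_sub hy hyx.le hx).1
  have : 0 < (x - y) / K := div_pos (by linarith) h.pos
  linarith

theorem tauV_strictAnti (h : P.IsBound K) {y x : ℝ} (hy : 0 ≤ y) (hyx : y < x) (hx : x ≤ 1) :
    P.tauV x < P.tauV y := by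
  have := (h.tauV_sub hy hyx.le hx).1
  have : 0 < (x - y) / K := div_pos (by linarith) h.pos
  linarith

theorem tauU_nonneg (h : P.IsBound K) {x : ℝ} (hx : x ∈ Icc (0 : ℝ) 1) : 0 ≤ P.tauU x := by
  simpa [tauU_zero] using h.tauU_mono le_rfl hx.1 hx.2

theorem tauV_nonneg (h : P.IsBound K) {x : ℝ} (hx : x ∈ Icc (0 : ℝ) 1) : 0 ≤ P.tauV x := by
  simpa [tauV_one] using h.tauV_anti hx.1 hx.2 le_rfl

theorem tauV_pos (h : P.IsBound K) {x : ℝ} (hx : 0 ≤ x) (hx' : x < 1) : 0 < P.tauV x := by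
  simpa [tauV_one] using h.tauV_strictAnti hx hx' le_rfl

theorem tauV_le (h : P.IsBound K) {x : ℝ} (hx : x ∈ Icc (0 : ℝ) 1) : P.tauV x ≤ K := by
  have := (h.tauV_sub hx.1 hx.2 le_rfl).2
  rw [tauV_one] at this
  nlinarith [hx.1, h.pos]

theorem continuousOn_tauU (h : P.IsBound K) : ContinuousOn P.tauU (Icc 0 1) := by
  have : LipschitzOnWith ⟨K, h.pos.le⟩ P.tauU (Icc 0 1) := by
    refine LipschitzOnWith.of_dist_le_mul fun x hx y hy => ?_
    rw [Real.dist_eq, Real.dist_eq]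
    rcases le_total y x with hyx | hxy
    · rw [abs_of_nonneg (sub_nonneg.2 hyx),
        abs_of_nonneg (sub_nonneg.2 (h.tauU_mono hy.1 hyx hx.2))]
      exact (h.tauU_sub hy.1 hyx hx.2).2
    · rw [abs_sub_comm, abs_sub_comm x, abs_of_nonneg (sub_nonneg.2 hxy),
        abs_of_nonneg (sub_nonneg.2 (h.tauU_mono hx.1 hxy hy.2))]
      exact (h.tauU_sub hx.1 hxy hy.2).2
  exact this.continuousOn

theorem continuousOn_tauV (h : P.IsBound K) : ContinuousOn P.tauV (Icc 0 1) := by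
  have : LipschitzOnWith ⟨K, h.pos.le⟩ P.tauV (Icc 0 1) := by
    refine LipschitzOnWith.of_dist_le_mul fun x hx y hy => ?_
    rw [Real.dist_eq, Real.dist_eq]
    rcases le_total y x with hyx | hxy
    · rw [abs_sub_comm, abs_of_nonneg (sub_nonneg.2 hyx),
        abs_of_nonneg (sub_nonneg.2 (h.tauV_anti hy.1 hyx hx.2))]
      exact (h.tauV_sub hy.1 hyx hx.2).2
    · rw [abs_sub_comm x, abs_of_nonneg (sub_nonneg.2 hxy),
        abs_of_nonneg (sub_nonneg.2 (h.tauV_anti hx.1 hxy hy.2))]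
      exact (h.tauV_sub hx.1 hxy hy.2).2
  exact this.continuousOn

/-- A characteristic of `u` whose times at `y` and `x` enclose `r` attains the time `r`. -/
theorem exists_tauU_eq (h : P.IsBound K) {y x θ r : ℝ} (hy : 0 ≤ y) (hyx : y ≤ x) (hx : x ≤ 1)
    (h1 : θ + P.tauU y ≤ r) (h2 : r ≤ θ + P.tauU x) : ∃ z ∈ Icc y x, θ + P.tauU z = r := by
  have hc : ContinuousOn (fun z => θ + P.tauU z) (Icc y x) :=
    continuousOn_const.add (h.continuousOn_tauU.mono (Icc_subset_Icc hy hx))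
  exact intermediate_value_Icc hyx hc ⟨h1, h2⟩

/-- A characteristic of `v` whose times at `y` and `x` enclose `r` attains the time `r`. -/
theorem exists_tauV_eq (h : P.IsBound K) {x y θ r : ℝ} (hx : 0 ≤ x) (hxy : x ≤ y) (hy : y ≤ 1)
    (h1 : θ + P.tauV y ≤ r) (h2 : r ≤ θ + P.tauV x) : ∃ z ∈ Icc x y, θ + P.tauV z = r := by
  have hc : ContinuousOn (fun z => θ + P.tauV z) (Icc x y) :=
    continuousOn_const.add (h.continuousOn_tauV.mono (Icc_subset_Icc hx hy))
  exact intermediate_value_Icc' hxy hc ⟨h1, h2⟩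

end IsBound

/-! ### Broad solutions along characteristics -/

/-- The equation for `u` along the characteristic `(ξ, θ + τᵘ(ξ))`. -/
theorem IsBroadSolution.u_line {Du Dv : Set (ℝ × ℝ)} {t₀ : ℝ} {w₀ : ℝ → ℝ × ℝ}
    {w : ℝ → ℝ → ℝ × ℝ} (hw : P.IsBroadSolution Du Dv t₀ w₀ w) {x y θ : ℝ} (hyx : y ≤ x)
    (h1 : (x, θ + P.tauU x) ∈ Du) (h2 : (y, θ + P.tauU y) ∈ Du) :
    (w x (θ + P.tauU x)).1 = (w y (θ + P.tauU y)).1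
      + ∫ ξ in y..x, P.rhsU (w ξ (θ + P.tauU ξ)) ξ := by
  have hring : ∀ ξ, θ + P.tauU x - (P.tauU x - P.tauU ξ) = θ + P.tauU ξ := fun ξ => by ring
  have := hw.u_eq x y (θ + P.tauU x) hyx h1 (by rw [hring]; exact h2)
  simp only [hring] at this
  exact this

/-- The equation for `v` along the characteristic `(ξ, θ + τᵛ(ξ))`. -/
theorem IsBroadSolution.v_line {Du Dv : Set (ℝ × ℝ)} {t₀ : ℝ} {w₀ : ℝ → ℝ × ℝ}
    {w : ℝ → ℝ → ℝ × ℝ} (hw : P.IsBroadSolution Du Dv t₀ w₀ w) {x y θ : ℝ} (hxy : x ≤ y)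
    (h1 : (x, θ + P.tauV x) ∈ Dv) (h2 : (y, θ + P.tauV y) ∈ Dv) :
    (w x (θ + P.tauV x)).2 = (w y (θ + P.tauV y)).2
      + ∫ ξ in x..y, P.rhsV (w ξ (θ + P.tauV ξ)) ξ := by
  have hring : ∀ ξ, θ + P.tauV x - (P.tauV x - P.tauV ξ) = θ + P.tauV ξ := fun ξ => by ring
  have := hw.v_eq x y (θ + P.tauV x) hxy h1 (by rw [hring]; exact h2)
  simp only [hring] at this
  exact this

/-- A broad solution on larger domains, with the state at a later time as its initial state. -/
theorem IsBroadSolution.restrict {Du Dv Du' Dv' : Set (ℝ × ℝ)} {t₀ : ℝ} {w₀ : ℝ → ℝ × ℝ}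
    {w : ℝ → ℝ → ℝ × ℝ} (hw : P.IsBroadSolution Du Dv t₀ w₀ w) (hu : Du' ⊆ Du) (hv : Dv' ⊆ Dv)
    (r : ℝ) : P.IsBroadSolution Du' Dv' r (fun x => w x r) w where
  measurable := hw.measurable
  bounded_u := hw.bounded_u.imp fun _ hC p hp => hC p (hu hp)
  bounded_v := hw.bounded_v.imp fun _ hC p hp => hC p (hv hp)
  u_eq x y t h h1 h2 := hw.u_eq x y t h (hu h1) (hu h2)
  v_eq x y t h h1 h2 := hw.v_eq x y t h (hv h1) (hv h2)
  u_bc t h1 h2 := hw.u_bc t (hu h1) (hv h2)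
  u_init _ _ := rfl
  v_init _ _ := rfl

theorem IsBroadSolution.aemeasurable_line {Du Dv : Set (ℝ × ℝ)} {t₀ : ℝ} {w₀ : ℝ → ℝ × ℝ}
    {w : ℝ → ℝ → ℝ × ℝ} (hw : P.IsBroadSolution Du Dv t₀ w₀ w) {τ : ℝ → ℝ}
    (hτ : ContinuousOn τ (Icc 0 1)) (θ : ℝ) :
    AEMeasurable (fun ξ => w ξ (θ + τ ξ)) (volume.restrict (Icc 0 1)) :=
  hw.measurable.comp_aemeasurable (g := fun p : ℝ × ℝ => w p.1 p.2) (f := fun ξ => (ξ, θ + τ ξ))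
    (aemeasurable_id.prodMk ((continuousOn_const.add hτ).aemeasurable measurableSet_Icc))

/-- Up to time `r` the whole interval `[0,1]`, and after that the determinate set of `u` at
time `r`. -/
def domU (P : HypModel) (a r : ℝ) : Set (ℝ × ℝ) :=
  {p | p.1 ∈ Icc (0 : ℝ) 1 ∧ a ≤ p.2 ∧ p.2 ≤ r + P.tauV p.1}

/-- Up to time `r` the whole interval `[0,1]`, and after that the determinate set of `v` at
time `r`. The point `(1, r)` is not included. -/
def domV (P : HypModel) (a r : ℝ) : Set (ℝ × ℝ) :=
  {p | p.1 ∈ Icc (0 : ℝ) 1 ∧ a ≤ p.2 ∧ p.2 < r + P.tauV p.1}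

/-- The part of `domU` that is reached from the data: the corner `(0, r + τᵛ(0))`, at which
no equation determines `u`, is removed. -/
def coreU (P : HypModel) (a r : ℝ) : Set (ℝ × ℝ) :=
  {p | p ∈ P.domU a r ∧ p.2 - P.tauU p.1 < r + P.tauV 0}

theorem domU_mono {a r a' r' : ℝ} (ha : a ≤ a') (hr : r' ≤ r) : P.domU a' r' ⊆ P.domU a r :=
  fun _ hp => ⟨hp.1, ha.trans hp.2.1, hp.2.2.trans (by linarith)⟩

theorem domV_mono {a r a' r' : ℝ} (ha : a ≤ a') (hr : r' ≤ r) : P.domV a' r' ⊆ P.domV a r :=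
  fun _ hp => ⟨hp.1, ha.trans hp.2.1, hp.2.2.trans_le (by linarith)⟩

theorem IsBound.mem_coreU (h : P.IsBound K) {a r x s : ℝ} (hp : (x, s) ∈ P.domU a r)
    (hx : 0 < x) : (x, s) ∈ P.coreU a r := by
  refine ⟨hp, ?_⟩
  have h1 := hp.2.2
  have h2 := h.tauU_strictMono le_rfl hx hp.1.2
  have h3 := h.tauV_strictAnti le_rfl hx hp.1.2
  rw [IsBound.tauU_zero] at h2
  dsimp only at h1 ⊢
  linarith

theorem norm_pair_le {a : ℝ × ℝ} {C : ℝ} (h1 : |a.1| ≤ C) (h2 : |a.2| ≤ C) : ‖a‖ ≤ C := by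
  rw [Prod.norm_def]
  exact max_le h1 h2

/-- The zero function is a broad solution with zero initial state. -/
theorem isBroadSolution_zero {Du Dv : Set (ℝ × ℝ)} {t₀ : ℝ} (hu : ∀ p ∈ Du, p.1 ∈ Icc (0 : ℝ) 1)
    (hv : ∀ p ∈ Dv, p.1 ∈ Icc (0 : ℝ) 1) (ht : ∀ p ∈ Du, 0 ≤ p.2) :
    P.IsBroadSolution Du Dv t₀ (fun _ => 0) (fun _ _ => 0) where
  measurable := measurable_const
  bounded_u := ⟨0, by simp⟩
  bounded_v := ⟨0, by simp⟩
  u_eq x y t hyx h1 h2 := by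
    have : ∀ ξ ∈ uIcc y x, P.fU 0 ξ / P.lamU ξ = 0 := by
      intro ξ hξ
      rw [uIcc_of_le hyx] at hξ
      rw [P.fU_zero ξ ⟨(hu _ h2).1.trans hξ.1, hξ.2.trans (hu _ h1).2⟩, zero_div]
    rw [intervalIntegral.integral_congr this]
    simp
  v_eq x y t hxy h1 h2 := by
    have : ∀ ξ ∈ uIcc x y, P.fV 0 ξ / P.lamV ξ = 0 := by
      intro ξ hξ
      rw [uIcc_of_le hxy] at hξ
      rw [P.fV_zero ξ ⟨(hv _ h1).1.trans hξ.1, hξ.2.trans (hv _ h2).2⟩, zero_div]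
    rw [intervalIntegral.integral_congr this]
    simp
  u_bc t h1 _ := by
    have := P.g_zero t (ht _ h1)
    simpa using this.symm
  u_init _ _ := rfl
  v_init _ _ := rfl

namespace IsBound

theorem mem_of_lineU (h : P.IsBound K) {a r x y θ : ℝ} (hx : (x, θ + P.tauU x) ∈ P.coreU a r)
    (hy : 0 ≤ y) (ha : a ≤ θ + P.tauU y) {ξ : ℝ} (hξ : ξ ∈ Ico y x) :
    (ξ, θ + P.tauU ξ) ∈ P.coreU a r ∧ (ξ, θ + P.tauU ξ) ∈ P.domV a r := by
  have hx0 := hx.1.1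
  have h1 := h.tauU_mono hy hξ.1 (hξ.2.le.trans hx0.2)
  have h2 := h.tauU_strictMono (hy.trans hξ.1) hξ.2 hx0.2
  have h3 := h.tauV_anti (hy.trans hξ.1) hξ.2.le hx0.2
  have h4 := hx.1.2.2
  have h5 := hx.2
  dsimp only at h4 h5
  exact ⟨⟨⟨⟨hy.trans hξ.1, hξ.2.le.trans hx0.2⟩, ha.trans (by simpa using h1),
      by dsimp only; linarith⟩, by dsimp only; linarith⟩,
    ⟨hy.trans hξ.1, hξ.2.le.trans hx0.2⟩, ha.trans (by simpa using h1), by dsimp only; linarith⟩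

theorem mem_of_lineV (h : P.IsBound K) {a r x y θ : ℝ} (hx : (x, θ + P.tauV x) ∈ P.domV a r)
    (hy : y ≤ 1) (ha : a ≤ θ + P.tauV y) {ξ : ℝ} (hξ : ξ ∈ Icc x y) :
    (ξ, θ + P.tauV ξ) ∈ P.coreU a r ∧ (ξ, θ + P.tauV ξ) ∈ P.domV a r := by
  have hξ0 : ξ ∈ Icc (0 : ℝ) 1 := ⟨hx.1.1.trans hξ.1, hξ.2.trans hy⟩
  have h1 := h.tauV_anti hξ0.1 hξ.2 hy
  have h2 := h.tauV_anti le_rfl hξ0.1 hξ0.2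
  have h3 := h.tauU_nonneg hξ0
  have h4 := hx.2.2
  dsimp only at h4
  exact ⟨⟨⟨hξ0, by dsimp only; linarith, by dsimp only; linarith⟩, by dsimp only; linarith⟩,
    hξ0, by dsimp only; linarith, by dsimp only; linarith⟩

/-- Difference of two integrals of a rate along the same curve. -/
theorem abs_integral_sub_le {L : ℝ} {f : ℝ × ℝ → ℝ → ℝ} (hf : IsRate L f) {c d : ℝ → ℝ × ℝ}
    (hc : AEMeasurable c (volume.restrict (Icc 0 1)))
    (hd : AEMeasurable d (volume.restrict (Icc 0 1))) {y x C D : ℝ} (hy : 0 ≤ y) (hyx : y ≤ x)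
    (hx : x ≤ 1) (hC : ∀ ξ ∈ Ioo y x, ‖c ξ‖ ≤ C) (hD : ∀ ξ ∈ Ioo y x, ‖d ξ‖ ≤ D) :
    (∫ ξ in y..x, f (c ξ) ξ) - (∫ ξ in y..x, f (d ξ) ξ) = ∫ ξ in y..x, (f (c ξ) ξ - f (d ξ) ξ) :=
  (intervalIntegral.integral_sub (hf.intervalIntegrable hc hy hyx hx hC)
    (hf.intervalIntegrable hd hy hyx hx hD)).symm

end IsBound

/-- Stability constant of the Cauchy problem with an input over a time horizon of at most `1`
plus the determinate set. -/
def stabConst (K : ℝ) : ℝ := 2 * K * Real.exp (4 * K ^ 4 * (1 + K))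

theorem stabConst_nonneg (hK : 0 < K) : 0 ≤ stabConst K := by
  rw [stabConst]; positivity

/-- Stability of broad solutions with respect to the initial state and the input. The weight
`exp (k (s - a))` in time makes the contributions of the integrals along characteristics small,
because time runs at least at the rate `1 / K` along a characteristic; the factor `K` on the
`v`-component absorbs the boundary condition. -/
theorem IsBound.stability (h : P.IsBound K) {a r : ℝ} (ha : 0 ≤ a) (hr : r ≤ a + 1)
    {w₁ w₂ : ℝ → ℝ × ℝ} {W₁ W₂ : ℝ → ℝ → ℝ × ℝ}
    (H₁ : P.IsBroadSolution (P.domU a r) (P.domV a r) a w₁ W₁)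
    (H₂ : P.IsBroadSolution (P.domU a r) (P.domV a r) a w₂ W₂) {B : ℝ} (hB : 0 ≤ B)
    (hu : ∀ x ∈ Ioc (0 : ℝ) 1, |(w₁ x).1 - (w₂ x).1| ≤ B)
    (hv : ∀ x ∈ Ico (0 : ℝ) 1, |(w₁ x).2 - (w₂ x).2| ≤ B)
    (hin : ∀ s, a ≤ s → s < r → |(W₁ 1 s).2 - (W₂ 1 s).2| ≤ B) :
    (∀ p ∈ P.coreU a r, |(W₁ p.1 p.2).1 - (W₂ p.1 p.2).1| ≤ stabConst K * B) ∧
      ∀ p ∈ P.domV a r, |(W₁ p.1 p.2).2 - (W₂ p.1 p.2).2| ≤ stabConst K * B := by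
  have hK := h.pos
  have hK1 := h.one_le
  obtain ⟨C₁, hC₁⟩ := H₁.bounded_u
  obtain ⟨D₁, hD₁⟩ := H₁.bounded_v
  obtain ⟨C₂, hC₂⟩ := H₂.bounded_u
  obtain ⟨D₂, hD₂⟩ := H₂.bounded_v
  set k : ℝ := 4 * K ^ 4 with hk
  have hkpos : 0 < k := by positivity
  set ω : ℝ × ℝ → ℝ := fun p => Real.exp (k * (p.2 - a)) with hω
  have hω1 : ∀ p : ℝ × ℝ, a ≤ p.2 → 1 ≤ ω p := fun p hp =>
    Real.one_le_exp (mul_nonneg hkpos.le (sub_nonneg.2 hp))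
  have hω0 : ∀ p, 0 < ω p := fun p => Real.exp_pos _
  -- along a characteristic the weight decays exponentially in the position
  have hdecay : ∀ (x ξ s s' d : ℝ), d / K ≤ s - s' →
      ω (ξ, s') ≤ ω (x, s) * Real.exp (-(k / K * d)) := by
    intro x ξ s s' d hd
    simp only [hω]
    rw [← Real.exp_add]
    apply Real.exp_le_exp.2
    have := mul_le_mul_of_nonneg_left hd hkpos.le
    have e1 : k / K * d = k * (d / K) := by ring
    rw [e1]
    linarith
  have hkK : ∀ b : ℝ, K ^ 2 * b / (k / K) = b / (4 * K) := by
    intro b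
    rw [hk]; field_simp
  have main := weighted_sup_bound (S := P.coreU a r) (T := P.domV a r)
    (φ := fun p => |(W₁ p.1 p.2).1 - (W₂ p.1 p.2).1|)
    (ψ := fun p => K * |(W₁ p.1 p.2).2 - (W₂ p.1 p.2).2|) (ω := ω) (A := K * B)
    (fun p => (hω0 p).le) ?_ ?_ (by positivity)
  · have hωle : ∀ p : ℝ × ℝ, p.2 ≤ r + K → ω p ≤ Real.exp (k * (1 + K)) := fun p hp =>
      Real.exp_le_exp.2 (mul_le_mul_of_nonneg_left (by linarith) hkpos.le)
    have hKB : 0 ≤ 2 * (K * B) := by positivity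
    have hfin : ∀ p : ℝ × ℝ, p.2 ≤ r + K → 2 * (K * B) * ω p ≤ stabConst K * B := fun p hp => by
      refine (mul_le_mul_of_nonneg_left (hωle p hp) hKB).trans (le_of_eq ?_)
      rw [stabConst]; ring
    refine ⟨fun p hp => (main.1 p hp).trans (hfin p ?_), fun p hp => ?_⟩
    · have := h.tauV_le hp.1.1
      linarith [hp.1.2.2]
    · have h1 := (main.2 p hp).trans (hfin p (by
        have := h.tauV_le hp.1
        linarith [hp.2.2]))
      have h2 := abs_nonneg ((W₁ p.1 p.2).2 - (W₂ p.1 p.2).2)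
      nlinarith
  · refine ⟨(|C₁| + |C₂|) + K * (|D₁| + |D₂|), fun p hp => ?_, fun p hp => ?_⟩
    · have h1 := hC₁ p hp.1
      have h2 := hC₂ p hp.1
      have h3 := abs_sub (W₁ p.1 p.2).1 (W₂ p.1 p.2).1
      have h4 := le_abs_self C₁
      have h5 := le_abs_self C₂
      have h6 := hω1 p hp.1.2.1
      have h7 : 0 ≤ K * (|D₁| + |D₂|) := by positivity
      nlinarith [mul_nonneg (show 0 ≤ (|C₁| + |C₂|) + K * (|D₁| + |D₂|) by positivity)
        (sub_nonneg.2 h6)]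
    · have h1 := hD₁ p hp
      have h2 := hD₂ p hp
      have h3 := abs_sub (W₁ p.1 p.2).2 (W₂ p.1 p.2).2
      have h4 := le_abs_self D₁
      have h5 := le_abs_self D₂
      have h6 := hω1 p hp.2.1
      have h7 : 0 ≤ |C₁| + |C₂| := by positivity
      have h8 : K * |(W₁ p.1 p.2).2 - (W₂ p.1 p.2).2| ≤ K * (|D₁| + |D₂|) :=
        mul_le_mul_of_nonneg_left (by linarith) hK.le
      nlinarith [mul_nonneg (show 0 ≤ (|C₁| + |C₂|) + K * (|D₁| + |D₂|) by positivity)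
        (sub_nonneg.2 h6)]
  · intro m hm hφ hψ
    have hnorm : ∀ p ∈ P.coreU a r, p ∈ P.domV a r →
        ‖W₁ p.1 p.2 - W₂ p.1 p.2‖ ≤ m * ω p := by
      intro p hp hp'
      refine norm_pair_le (hφ p hp) ?_
      have := hψ p hp'
      have h2 := abs_nonneg ((W₁ p.1 p.2).2 - (W₂ p.1 p.2).2)
      rw [Prod.snd_sub]
      nlinarith
    have hn1 : ∀ p ∈ P.coreU a r, p ∈ P.domV a r → ‖W₁ p.1 p.2‖ ≤ max C₁ D₁ := fun p hp hp' =>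
      norm_pair_le ((hC₁ p hp.1).trans (le_max_left _ _)) ((hD₁ p hp').trans (le_max_right _ _))
    have hn2 : ∀ p ∈ P.coreU a r, p ∈ P.domV a r → ‖W₂ p.1 p.2‖ ≤ max C₂ D₂ := fun p hp hp' =>
      norm_pair_le ((hC₂ p hp.1).trans (le_max_left _ _)) ((hD₂ p hp').trans (le_max_right _ _))
    have hV : ∀ p ∈ P.domV a r,
        |(W₁ p.1 p.2).2 - (W₂ p.1 p.2).2| ≤ B + m * ω p / (4 * K) := by
      rintro ⟨x, s⟩ hp
      obtain ⟨θ, rfl⟩ : ∃ θ, s = θ + P.tauV x := ⟨s - P.tauV x, by ring⟩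
      obtain ⟨y, hxy, hy1, hay, hyB⟩ : ∃ y, x ≤ y ∧ y ≤ 1 ∧ a ≤ θ + P.tauV y ∧
          |(W₁ y (θ + P.tauV y)).2 - (W₂ y (θ + P.tauV y)).2| ≤ B := by
        have hs := hp.2.2
        dsimp only at hs
        rcases le_or_gt a θ with hθ | hθ
        · refine ⟨1, hp.1.2, le_rfl, ?_, ?_⟩ <;> rw [tauV_one, add_zero]
          · exact hθ
          · exact hin θ hθ (by linarith)
        · obtain ⟨y, hy, hya⟩ := h.exists_tauV_eq hp.1.1 hp.1.2 le_rfl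
            (by rw [tauV_one]; linarith) hp.2.1
          have hy1 : y < 1 := by
            refine lt_of_le_of_ne hy.2 fun e => ?_
            rw [e, tauV_one] at hya
            linarith
          refine ⟨y, hy.1, hy.2, hya.ge, ?_⟩
          have hy' : y ∈ Ico (0 : ℝ) 1 := ⟨hp.1.1.trans hy.1, hy1⟩
          rw [hya, H₁.v_init y hy', H₂.v_init y hy']
          exact hv y hy'
      have hmem := fun ξ hξ => h.mem_of_lineV (ξ := ξ) hp hy1 hay hξ
      have e1 := H₁.v_line hxy hp (hmem y (right_mem_Icc.2 hxy)).2
      have e2 := H₂.v_line hxy hp (hmem y (right_mem_Icc.2 hxy)).2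
      have e3 := abs_integral_sub_le h.rateV (H₁.aemeasurable_line h.continuousOn_tauV θ)
        (H₂.aemeasurable_line h.continuousOn_tauV θ) hp.1.1 hxy hy1
        (fun ξ hξ => hn1 _ (hmem ξ (Ioo_subset_Icc_self hξ)).1 (hmem ξ (Ioo_subset_Icc_self hξ)).2)
        (fun ξ hξ => hn2 _ (hmem ξ (Ioo_subset_Icc_self hξ)).1 (hmem ξ (Ioo_subset_Icc_self hξ)).2)
      have e4 := abs_integral_le_exp_right (k := k / K) (B := K ^ 2 * (m * ω (x, θ + P.tauV x)))
        (F := fun ξ => P.rhsV (W₁ ξ (θ + P.tauV ξ)) ξ - P.rhsV (W₂ ξ (θ + P.tauV ξ)) ξ)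
        (by positivity) (by have := hω0 (x, θ + P.tauV x); positivity) hxy (fun ξ hξ => by
          have hξm := hmem ξ (Ioo_subset_Icc_self hξ)
          have h1 := h.rateV.sub_le ξ hξm.2.1 (W₁ ξ (θ + P.tauV ξ)) (W₂ ξ (θ + P.tauV ξ))
          have h2 := hnorm _ hξm.1 hξm.2
          have h3 := hdecay x ξ (θ + P.tauV x) (θ + P.tauV ξ) (ξ - x)
            (by linarith [(h.tauV_sub hp.1.1 hξ.1.le (hξ.2.le.trans hy1)).1])
          calc _ ≤ K ^ 2 * ‖W₁ ξ (θ + P.tauV ξ) - W₂ ξ (θ + P.tauV ξ)‖ := h1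
            _ ≤ K ^ 2 * (m * (ω (x, θ + P.tauV x) * Real.exp (-(k / K * (ξ - x))))) :=
              mul_le_mul_of_nonneg_left (h2.trans (mul_le_mul_of_nonneg_left h3 hm))
                (by positivity)
            _ = _ := by ring)
      rw [hkK, ← e3] at e4
      dsimp only
      rw [e1, e2, add_sub_add_comm]
      exact (abs_add_le _ _).trans (add_le_add hyB e4)
    have hψ' : ∀ p ∈ P.domV a r, K * |(W₁ p.1 p.2).2 - (W₂ p.1 p.2).2| ≤ K * B + m * ω p / 4 := by
      intro p hp
      refine (mul_le_mul_of_nonneg_left (hV p hp) hK.le).trans (le_of_eq ?_)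
      field_simp
    refine ⟨?_, fun p hp => ?_⟩
    · rintro ⟨x, s⟩ hp
      obtain ⟨θ, rfl⟩ : ∃ θ, s = θ + P.tauU x := ⟨s - P.tauU x, by ring⟩
      have hω1x := hω1 (x, θ + P.tauU x) hp.1.2.1
      obtain ⟨y, hy0, hyx, hay, hyB⟩ : ∃ y, 0 ≤ y ∧ y ≤ x ∧ a ≤ θ + P.tauU y ∧
          |(W₁ y (θ + P.tauU y)).1 - (W₂ y (θ + P.tauU y)).1| ≤
            K * B + m * ω (x, θ + P.tauU x) / 4 := by
        rcases le_or_gt a θ with hθ | hθ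
        · refine ⟨0, le_rfl, hp.1.1.1, ?_, ?_⟩ <;> rw [tauU_zero, add_zero]
          · exact hθ
          · have hθr : θ < r + P.tauV 0 := by
              have := hp.2
              dsimp only at this
              linarith
            have m1 : ((0 : ℝ), θ) ∈ P.domU a r := ⟨by simp, hθ, hθr.le⟩
            have m2 : ((0 : ℝ), θ) ∈ P.domV a r := ⟨by simp, hθ, hθr⟩
            rw [H₁.u_bc θ m1 m2, H₂.u_bc θ m1 m2]
            refine (h.g_sub_le θ (ha.trans hθ) _ _).trans ((hψ' _ m2).trans ?_)
            have : ω ((0 : ℝ), θ) ≤ ω (x, θ + P.tauU x) :=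
              Real.exp_le_exp.2 (mul_le_mul_of_nonneg_left
                (by linarith [h.tauU_nonneg hp.1.1]) hkpos.le)
            have := mul_le_mul_of_nonneg_left this hm
            linarith
        · obtain ⟨y, hy, hya⟩ := h.exists_tauU_eq le_rfl hp.1.1.1 hp.1.1.2
            (by rw [tauU_zero]; linarith) hp.1.2.1
          have hy1 : 0 < y := by
            refine lt_of_le_of_ne hy.1 fun e => ?_
            rw [← e, tauU_zero] at hya
            linarith
          refine ⟨y, hy.1, hy.2, hya.ge, ?_⟩
          have hy' : y ∈ Ioc (0 : ℝ) 1 := ⟨hy1, hy.2.trans hp.1.1.2⟩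
          rw [hya, H₁.u_init y hy', H₂.u_init y hy']
          have h1 := hu y hy'
          have h2 : 0 ≤ m * ω (x, θ + P.tauU x) / 4 := by positivity
          nlinarith
      have hmem := fun ξ hξ => h.mem_of_lineU (ξ := ξ) hp hy0 hay hξ
      have hyD : (y, θ + P.tauU y) ∈ P.domU a r := by
        rcases eq_or_lt_of_le hyx with e | hlt
        · rw [e]; exact hp.1
        · exact (hmem y (left_mem_Ico.2 hlt)).1.1
      have e1 := H₁.u_line hyx hp.1 hyD
      have e2 := H₂.u_line hyx hp.1 hyD
      have e3 := abs_integral_sub_le h.rateU (H₁.aemeasurable_line h.continuousOn_tauU θ)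
        (H₂.aemeasurable_line h.continuousOn_tauU θ) hy0 hyx hp.1.1.2
        (fun ξ hξ => hn1 _ (hmem ξ (Ioo_subset_Ico_self hξ)).1 (hmem ξ (Ioo_subset_Ico_self hξ)).2)
        (fun ξ hξ => hn2 _ (hmem ξ (Ioo_subset_Ico_self hξ)).1 (hmem ξ (Ioo_subset_Ico_self hξ)).2)
      have e4 := abs_integral_le_exp_left (k := k / K) (B := K ^ 2 * (m * ω (x, θ + P.tauU x)))
        (F := fun ξ => P.rhsU (W₁ ξ (θ + P.tauU ξ)) ξ - P.rhsU (W₂ ξ (θ + P.tauU ξ)) ξ)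
        (by positivity) (by positivity) hyx (fun ξ hξ => by
          have hξm := hmem ξ (Ioo_subset_Ico_self hξ)
          have h1 := h.rateU.sub_le ξ hξm.2.1 (W₁ ξ (θ + P.tauU ξ)) (W₂ ξ (θ + P.tauU ξ))
          have h2 := hnorm _ hξm.1 hξm.2
          have h3 := hdecay x ξ (θ + P.tauU x) (θ + P.tauU ξ) (x - ξ)
            (by linarith [(h.tauU_sub (hy0.trans hξ.1.le) hξ.2.le hp.1.1.2).1])
          calc _ ≤ K ^ 2 * ‖W₁ ξ (θ + P.tauU ξ) - W₂ ξ (θ + P.tauU ξ)‖ := h1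
            _ ≤ K ^ 2 * (m * (ω (x, θ + P.tauU x) * Real.exp (-(k / K * (x - ξ))))) :=
              mul_le_mul_of_nonneg_left (h2.trans (mul_le_mul_of_nonneg_left h3 hm))
                (by positivity)
            _ = _ := by ring)
      rw [hkK, ← e3] at e4
      have e5 : m * ω (x, θ + P.tauU x) / (4 * K) ≤ m * ω (x, θ + P.tauU x) / 4 :=
        div_le_div_of_nonneg_left (by positivity) (by norm_num) (by linarith)
      have e6 : K * B ≤ K * B * ω (x, θ + P.tauU x) := le_mul_of_one_le_right (by positivity) hω1x
      dsimp only
      rw [e1, e2, add_sub_add_comm]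
      refine (abs_add_le _ _).trans ((add_le_add hyB (e4.trans e5)).trans ?_)
      linarith
    · have h1 := hψ' p hp
      have h2 := le_mul_of_one_le_right (show 0 ≤ K * B by positivity) (hω1 p hp.2.1)
      have h3 : 0 ≤ m * ω p := by positivity
      linarith

/-! ### Evolution in the position -/

/-- Bound by integration in the direction of increasing position. On the sets `Su`, `Sv`, the
characteristics are followed to smaller positions until a point where the component that they
transport is bounded by `A`: for `v`, this is a point of the boundary `x = 0` at a later time. -/
theorem IsBound.space_evolution (h : P.IsBound K) {Du Dv Su Sv : Set (ℝ × ℝ)} {t₀ : ℝ}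
    {w₀ : ℝ → ℝ × ℝ} {w : ℝ → ℝ → ℝ × ℝ} (hw : P.IsBroadSolution Du Dv t₀ w₀ w)
    (hSu : Su ⊆ Du) (hSv : Sv ⊆ Dv) (hSu' : ∀ p ∈ Su, p.1 ∈ Icc (0 : ℝ) 1)
    (hSv' : ∀ p ∈ Sv, p.1 ∈ Icc (0 : ℝ) 1) {A : ℝ} (hA : 0 ≤ A)
    (hu : ∀ x θ, (x, θ + P.tauU x) ∈ Su → ∃ y, 0 ≤ y ∧ y ≤ x ∧ (y, θ + P.tauU y) ∈ Du ∧
      |(w y (θ + P.tauU y)).1| ≤ A ∧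
      ∀ ξ ∈ Ioo y x, (ξ, θ + P.tauU ξ) ∈ Su ∧ (ξ, θ + P.tauU ξ) ∈ Sv)
    (hv : ∀ x θ, (x, θ + P.tauV x) ∈ Sv → (0, θ + P.tauV 0) ∈ Dv ∧
      |(w 0 (θ + P.tauV 0)).2| ≤ A ∧
      ∀ ξ ∈ Ioo 0 x, (ξ, θ + P.tauV ξ) ∈ Su ∧ (ξ, θ + P.tauV ξ) ∈ Sv) :
    (∀ p ∈ Su, |(w p.1 p.2).1| ≤ 2 * A * Real.exp (2 * K ^ 2)) ∧
      ∀ p ∈ Sv, |(w p.1 p.2).2| ≤ 2 * A * Real.exp (2 * K ^ 2) := by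
  have hK := h.pos
  obtain ⟨C, hC⟩ := hw.bounded_u
  obtain ⟨D, hD⟩ := hw.bounded_v
  set k : ℝ := 2 * K ^ 2 with hk
  have hkpos : 0 < k := by positivity
  set ω : ℝ × ℝ → ℝ := fun p => Real.exp (k * p.1) with hω
  have hω1 : ∀ p : ℝ × ℝ, 0 ≤ p.1 → 1 ≤ ω p := fun p hp =>
    Real.one_le_exp (mul_nonneg hkpos.le hp)
  have hω0 : ∀ p, 0 < ω p := fun p => Real.exp_pos _
  have main := weighted_sup_bound (S := Su) (T := Sv)
    (φ := fun p => |(w p.1 p.2).1|) (ψ := fun p => |(w p.1 p.2).2|) (ω := ω) (A := A)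
    (fun p => (hω0 p).le) ?_ ?_ hA
  · have hfin : ∀ p : ℝ × ℝ, p.1 ∈ Icc (0 : ℝ) 1 → 2 * A * ω p ≤ 2 * A * Real.exp k := fun p hp =>
      mul_le_mul_of_nonneg_left (Real.exp_le_exp.2 (by nlinarith [hp.2])) (by positivity)
    exact ⟨fun p hp => (main.1 p hp).trans (hfin p (hSu' p hp)),
      fun p hp => (main.2 p hp).trans (hfin p (hSv' p hp))⟩
  · refine ⟨|C| + |D|, fun p hp => ?_, fun p hp => ?_⟩
    · have h1 := hC p (hSu hp)
      have h2 := le_abs_self C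
      have h3 := abs_nonneg D
      have h4 := hω1 p (hSu' p hp).1
      nlinarith [abs_nonneg C]
    · have h1 := hD p (hSv hp)
      have h2 := le_abs_self D
      have h3 := abs_nonneg C
      have h4 := hω1 p (hSv' p hp).1
      nlinarith [abs_nonneg D]
  · intro m hm hφ hψ
    have hstep : ∀ (x y : ℝ) (f : ℝ × ℝ → ℝ → ℝ) (τ : ℝ → ℝ), IsRate (K ^ 2) f → 0 ≤ y → y ≤ x →
        x ≤ 1 → (∀ ξ ∈ Ioo y x, (ξ, τ ξ) ∈ Su ∧ (ξ, τ ξ) ∈ Sv) →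
        |∫ ξ in y..x, f (w ξ (τ ξ)) ξ| ≤ m / 2 * Real.exp (k * x) := by
      intro x y f τ hf hy hyx hx hmem
      have e := abs_integral_le_exp_left (k := k) (B := K ^ 2 * (m * Real.exp (k * x)))
        (F := fun ξ => f (w ξ (τ ξ)) ξ) hkpos (by positivity) hyx (fun ξ hξ => by
          have hξm := hmem ξ hξ
          have h1 := hf.abs_le (hSu' _ hξm.1) (w ξ (τ ξ))
          have h2 : ‖w ξ (τ ξ)‖ ≤ m * ω (ξ, τ ξ) := norm_pair_le (hφ _ hξm.1) (hψ _ hξm.2)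
          calc _ ≤ K ^ 2 * ‖w ξ (τ ξ)‖ := h1
            _ ≤ K ^ 2 * (m * Real.exp (k * ξ)) := mul_le_mul_of_nonneg_left h2 (by positivity)
            _ = K ^ 2 * (m * (Real.exp (k * x) * Real.exp (-(k * (x - ξ))))) := by
              rw [← Real.exp_add]; ring_nf
            _ = _ := by ring)
      refine e.trans (le_of_eq ?_)
      rw [hk]; field_simp
    refine ⟨?_, ?_⟩
    · rintro ⟨x, s⟩ hp
      obtain ⟨θ, rfl⟩ : ∃ θ, s = θ + P.tauU x := ⟨s - P.tauU x, by ring⟩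
      obtain ⟨y, hy0, hyx, hyD, hyA, hmem⟩ := hu x θ hp
      have hx := hSu' _ hp
      have e1 := hw.u_line hyx (hSu hp) hyD
      have e2 := hstep x y P.rhsU (fun ξ => θ + P.tauU ξ) h.rateU hy0 hyx hx.2 hmem
      have e3 := le_mul_of_one_le_right hA (hω1 (x, θ + P.tauU x) hx.1)
      dsimp only [hω] at e3 ⊢
      rw [e1]
      refine (abs_add_le _ _).trans ((add_le_add hyA e2).trans ?_)
      linarith
    · rintro ⟨x, s⟩ hp
      obtain ⟨θ, rfl⟩ : ∃ θ, s = θ + P.tauV x := ⟨s - P.tauV x, by ring⟩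
      obtain ⟨h0D, h0A, hmem⟩ := hv x θ hp
      have hx := hSv' _ hp
      have e1 := hw.v_line hx.1 h0D (hSv hp)
      have e2 := hstep x 0 P.rhsV (fun ξ => θ + P.tauV ξ) h.rateV le_rfl hx.1 hx.2 hmem
      have e3 := le_mul_of_one_le_right hA (hω1 (x, θ + P.tauV x) hx.1)
      dsimp only [hω] at e3 ⊢
      have e4 : (w x (θ + P.tauV x)).2 = (w 0 (θ + P.tauV 0)).2
          - ∫ ξ in (0 : ℝ)..x, P.rhsV (w ξ (θ + P.tauV ξ)) ξ := by rw [e1]; ring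
      rw [e4]
      refine (abs_sub _ _).trans ((add_le_add h0A e2).trans ?_)
      linarith

/-! ### Gluing and prediction -/

/-- A broad solution on `[0,1] × [a,r]` continued by a solution of the Cauchy problem on the
determinate sets at time `r`. At `(0,r)` the values of `u` agree because of the boundary
condition. -/
theorem IsBound.glue (h : P.IsBound K) {a r : ℝ} (har : a ≤ r) {wa : ℝ → ℝ × ℝ}
    {w w' : ℝ → ℝ → ℝ × ℝ} (H : P.IsBroadSolution (strip a r) (strip a r) a wa w)
    (H' : P.IsBroadSolution (P.detU r) (P.detV r) r (fun x => w x r) w') :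
    P.IsBroadSolution (P.domU a r) (P.domV a r) a wa
      (fun x s => if s ≤ r then w x s else w' x s) := by
  set W : ℝ → ℝ → ℝ × ℝ := fun x s => if s ≤ r then w x s else w' x s with hW
  have hWle : ∀ x s, s ≤ r → W x s = w x s := fun x s hs => if_pos hs
  have hWgt : ∀ x s, r < s → W x s = w' x s := fun x s hs => if_neg (not_le.2 hs)
  have hmeas : Measurable fun p : ℝ × ℝ => W p.1 p.2 :=
    Measurable.ite (measurableSet_le measurable_snd measurable_const) H.measurable H'.measurable
  have hstrip : ∀ p : ℝ × ℝ, p.1 ∈ Icc (0 : ℝ) 1 → a ≤ p.2 → p.2 ≤ r → p ∈ strip a r :=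
    fun p h1 h2 h3 => ⟨h1, h2, h3⟩
  obtain ⟨C₁, hC₁⟩ := H.bounded_u
  obtain ⟨C₂, hC₂⟩ := H'.bounded_u
  obtain ⟨D₁, hD₁⟩ := H.bounded_v
  obtain ⟨D₂, hD₂⟩ := H'.bounded_v
  have hbu : ∀ p ∈ P.domU a r, |(W p.1 p.2).1| ≤ max C₁ C₂ := by
    intro p hp
    rcases le_or_gt p.2 r with hr | hr
    · rw [hWle _ _ hr]; exact (hC₁ p (hstrip p hp.1 hp.2.1 hr)).trans (le_max_left _ _)
    · rw [hWgt _ _ hr]; exact (hC₂ p ⟨hp.1, hr.le, hp.2.2⟩).trans (le_max_right _ _)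
  have hbv : ∀ p ∈ P.domV a r, |(W p.1 p.2).2| ≤ max D₁ D₂ := by
    intro p hp
    rcases le_or_gt p.2 r with hr | hr
    · rw [hWle _ _ hr]; exact (hD₁ p (hstrip p hp.1 hp.2.1 hr)).trans (le_max_left _ _)
    · rw [hWgt _ _ hr]; exact (hD₂ p ⟨hp.1, hr.le, hp.2.2⟩).trans (le_max_right _ _)
  have hnorm : ∀ p, p ∈ P.domU a r → p ∈ P.domV a r →
      ‖W p.1 p.2‖ ≤ max (max C₁ C₂) (max D₁ D₂) := fun p h1 h2 =>
    norm_pair_le ((hbu p h1).trans (le_max_left _ _)) ((hbv p h2).trans (le_max_right _ _))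
  have hline : ∀ (τ : ℝ → ℝ), ContinuousOn τ (Icc 0 1) → ∀ θ,
      AEMeasurable (fun ξ => W ξ (θ + τ ξ)) (volume.restrict (Icc 0 1)) := fun τ hτ θ =>
    hmeas.comp_aemeasurable (g := fun p : ℝ × ℝ => W p.1 p.2) (f := fun ξ => (ξ, θ + τ ξ))
      (aemeasurable_id.prodMk ((continuousOn_const.add hτ).aemeasurable measurableSet_Icc))
  have hv_r : ∀ x ∈ Ico (0 : ℝ) 1, (w' x r).2 = (w x r).2 := H'.v_init
  have hu_r : ∀ x ∈ Icc (0 : ℝ) 1, (w' x r).1 = (w x r).1 := by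
    intro x hx
    rcases eq_or_lt_of_le hx.1 with e | hlt
    · have h0 : (0 : ℝ) < P.tauV 0 := h.tauV_pos le_rfl one_pos
      rw [← e, H'.u_bc r ⟨by simp, le_rfl, by dsimp only; linarith⟩
        ⟨by simp, le_rfl, by dsimp only; linarith⟩, hv_r 0 (by simp),
        H.u_bc r ⟨by simp, har, le_rfl⟩ ⟨by simp, har, le_rfl⟩]
    · exact H'.u_init x ⟨hlt, hx.2⟩
  refine ⟨hmeas, ⟨_, hbu⟩, ⟨_, hbv⟩, ?_, ?_, ?_, ?_, ?_⟩
  · intro x y t hyx h1 h2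
    obtain ⟨θ, rfl⟩ : ∃ θ, t = θ + P.tauU x := ⟨t - P.tauU x, by ring⟩
    have hring : ∀ ξ, θ + P.tauU x - (P.tauU x - P.tauU ξ) = θ + P.tauU ξ := fun ξ => by ring
    simp only [hring] at h2 ⊢
    change _ = _ + ∫ ξ in y..x, P.rhsU (W ξ (θ + P.tauU ξ)) ξ
    have hy := h2.1
    have hx := h1.1
    -- the part of a segment before, respectively after, the time `r`
    have before : ∀ z, y ≤ z → z ≤ x → θ + P.tauU z ≤ r →
        (w z (θ + P.tauU z)).1 = (w y (θ + P.tauU y)).1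
          + ∫ ξ in y..z, P.rhsU (W ξ (θ + P.tauU ξ)) ξ := by
      intro z hyz hzx hzr
      have hle : ∀ ξ ∈ Icc y z, θ + P.tauU ξ ≤ r := fun ξ hξ => by
        linarith [h.tauU_mono (hy.1.trans hξ.1) hξ.2 (hzx.trans hx.2)]
      have hge := h.tauU_mono hy.1 hyz (hzx.trans hx.2)
      have e := H.u_line hyz (hstrip (z, θ + P.tauU z) ⟨hy.1.trans hyz, hzx.trans hx.2⟩
        (by have := h2.2.1; dsimp only at this ⊢; linarith) hzr)
        (hstrip (y, θ + P.tauU y) hy h2.2.1 (hle y (left_mem_Icc.2 hyz)))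
      rw [e]
      congr 1
      refine intervalIntegral.integral_congr fun ξ hξ => ?_
      rw [uIcc_of_le hyz] at hξ
      simp only [hWle _ _ (hle ξ hξ)]
    have after : ∀ z, y ≤ z → z ≤ x → r ≤ θ + P.tauU z →
        (w' x (θ + P.tauU x)).1 = (w' z (θ + P.tauU z)).1
          + ∫ ξ in z..x, P.rhsU (W ξ (θ + P.tauU ξ)) ξ := by
      intro z hyz hzx hzr
      have hz0 := hy.1.trans hyz
      have hge := h.tauU_mono hz0 hzx hx.2
      have hanti := h.tauV_anti hz0 hzx hx.2
      have h12 := h1.2.2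
      dsimp only at h12
      have e := H'.u_line hzx (⟨hx, by dsimp only; linarith, h12⟩ : (x, _) ∈ P.detU r)
        (⟨⟨hz0, hzx.trans hx.2⟩, hzr, by dsimp only; linarith⟩ : (z, _) ∈ P.detU r)
      rw [e]
      congr 1
      refine intervalIntegral.integral_congr_ae (Filter.Eventually.of_forall fun ξ hξ => ?_)
      rw [uIoc_of_le hzx] at hξ
      have := h.tauU_strictMono hz0 hξ.1 (hξ.2.trans hx.2)
      simp only [hWgt ξ (θ + P.tauU ξ) (by linarith)]
    rcases le_or_gt (θ + P.tauU x) r with hxr | hxr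
    · have hyr : θ + P.tauU y ≤ r := by linarith [h.tauU_mono hy.1 hyx hx.2]
      rw [hWle _ _ hxr, hWle _ _ hyr]
      exact before x hyx le_rfl hxr
    · rcases lt_or_ge r (θ + P.tauU y) with hyr | hyr
      · rw [hWgt _ _ hxr, hWgt _ _ hyr]
        exact after y le_rfl hyx hyr.le
      · obtain ⟨z, hz, hzr⟩ := h.exists_tauU_eq hy.1 hyx hx.2 hyr hxr.le
        have e1 := before z hz.1 hz.2 hzr.le
        have e2 := after z hz.1 hz.2 hzr.ge
        have hz01 : z ∈ Icc (0 : ℝ) 1 := ⟨hy.1.trans hz.1, hz.2.trans hx.2⟩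
        have hbd : ∀ ξ ∈ Ioo y x, ‖W ξ (θ + P.tauU ξ)‖ ≤ max (max C₁ C₂) (max D₁ D₂) := by
          intro ξ hξ
          have g1 := h.tauU_mono hy.1 hξ.1.le (hξ.2.le.trans hx.2)
          have g2 := h.tauU_strictMono (hy.1.trans hξ.1.le) hξ.2 hx.2
          have g3 := h.tauV_anti (hy.1.trans hξ.1.le) hξ.2.le hx.2
          have g4 := h1.2.2
          have g5 := h2.2.1
          dsimp only at g4 g5
          have hξ01 : ξ ∈ Icc (0 : ℝ) 1 := ⟨hy.1.trans hξ.1.le, hξ.2.le.trans hx.2⟩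
          exact hnorm (ξ, θ + P.tauU ξ) ⟨hξ01, by dsimp only; linarith, by dsimp only; linarith⟩
            ⟨hξ01, by dsimp only; linarith, by dsimp only; linarith⟩
        have i1 := h.rateU.intervalIntegrable (hline _ h.continuousOn_tauU θ) hy.1 hz.1 hz01.2
          (fun ξ hξ => hbd ξ ⟨hξ.1, hξ.2.trans_le hz.2⟩)
        have i2 := h.rateU.intervalIntegrable (hline _ h.continuousOn_tauU θ) hz01.1 hz.2 hx.2
          (fun ξ hξ => hbd ξ ⟨hz.1.trans_lt hξ.1, hξ.2⟩)
        rw [hWgt _ _ hxr, hWle _ _ hyr, e2,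
          ← intervalIntegral.integral_add_adjacent_intervals i1 i2, ← add_assoc, ← e1, hzr,
          hu_r z hz01]
  · intro x y t hxy h1 h2
    obtain ⟨θ, rfl⟩ : ∃ θ, t = θ + P.tauV x := ⟨t - P.tauV x, by ring⟩
    have hring : ∀ ξ, θ + P.tauV x - (P.tauV x - P.tauV ξ) = θ + P.tauV ξ := fun ξ => by ring
    simp only [hring] at h2 ⊢
    change _ = _ + ∫ ξ in x..y, P.rhsV (W ξ (θ + P.tauV ξ)) ξ
    have hy := h2.1
    have hx := h1.1
    have hθ : θ < r := by
      have := h1.2.2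
      dsimp only at this
      linarith
    have before : ∀ z, x ≤ z → z ≤ y → θ + P.tauV z ≤ r →
        (w z (θ + P.tauV z)).2 = (w y (θ + P.tauV y)).2
          + ∫ ξ in z..y, P.rhsV (W ξ (θ + P.tauV ξ)) ξ := by
      intro z hxz hzy hzr
      have hle : ∀ ξ ∈ Icc z y, θ + P.tauV ξ ≤ r := fun ξ hξ => by
        linarith [h.tauV_anti (hx.1.trans hxz) hξ.1 (hξ.2.trans hy.2)]
      have hge := h.tauV_anti (hx.1.trans hxz) hzy hy.2
      have e := H.v_line hzy (hstrip (z, θ + P.tauV z) ⟨hx.1.trans hxz, hzy.trans hy.2⟩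
        (by have := h2.2.1; dsimp only at this ⊢; linarith) hzr)
        (hstrip (y, θ + P.tauV y) hy h2.2.1 (hle y (right_mem_Icc.2 hzy)))
      rw [e]
      congr 1
      refine intervalIntegral.integral_congr fun ξ hξ => ?_
      rw [uIcc_of_le hzy] at hξ
      simp only [hWle _ _ (hle ξ hξ)]
    have after : ∀ z, x ≤ z → z ≤ y → r ≤ θ + P.tauV z →
        (w' x (θ + P.tauV x)).2 = (w' z (θ + P.tauV z)).2
          + ∫ ξ in x..z, P.rhsV (W ξ (θ + P.tauV ξ)) ξ := by
      intro z hxz hzy hzr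
      have hge := h.tauV_anti hx.1 hxz (hzy.trans hy.2)
      have e := H'.v_line hxz
        (⟨hx, by dsimp only; linarith, by dsimp only; linarith⟩ : (x, _) ∈ P.detV r)
        (⟨⟨hx.1.trans hxz, hzy.trans hy.2⟩, hzr, by dsimp only; linarith⟩ : (z, _) ∈ P.detV r)
      rw [e]
      congr 1
      refine intervalIntegral.integral_congr_ae ?_
      filter_upwards [compl_mem_ae_iff.2 (measure_singleton z)] with ξ hξz hξ
      rw [uIoc_of_le hxz] at hξ
      have := h.tauV_strictAnti (hx.1.trans hξ.1.le) (lt_of_le_of_ne hξ.2 hξz) (hzy.trans hy.2)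
      simp only [hWgt ξ (θ + P.tauV ξ) (by linarith)]
    rcases le_or_gt (θ + P.tauV x) r with hxr | hxr
    · have hyr : θ + P.tauV y ≤ r := by linarith [h.tauV_anti hx.1 hxy hy.2]
      rw [hWle _ _ hxr, hWle _ _ hyr]
      exact before x le_rfl hxy hxr
    · rcases lt_or_ge r (θ + P.tauV y) with hyr | hyr
      · rw [hWgt _ _ hxr, hWgt _ _ hyr]
        exact after y hxy le_rfl hyr.le
      · obtain ⟨z, hz, hzr⟩ := h.exists_tauV_eq hx.1 hxy hy.2 hyr hxr.le
        have e1 := before z hz.1 hz.2 hzr.le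
        have e2 := after z hz.1 hz.2 hzr.ge
        have hz01 : z ∈ Icc (0 : ℝ) 1 := ⟨hx.1.trans hz.1, hz.2.trans hy.2⟩
        have hz1 : z < 1 := by
          refine lt_of_le_of_ne hz01.2 fun e => ?_
          rw [e, tauV_one] at hzr
          linarith
        have hbd : ∀ ξ ∈ Ioo x y, ‖W ξ (θ + P.tauV ξ)‖ ≤ max (max C₁ C₂) (max D₁ D₂) := by
          intro ξ hξ
          have hm := h.mem_of_lineV h1 hy.2 h2.2.1 (Ioo_subset_Icc_self hξ)
          exact hnorm _ hm.1.1 hm.2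
        have i1 := h.rateV.intervalIntegrable (hline _ h.continuousOn_tauV θ) hx.1 hz.1 hz01.2
          (fun ξ hξ => hbd ξ ⟨hξ.1, hξ.2.trans_le hz.2⟩)
        have i2 := h.rateV.intervalIntegrable (hline _ h.continuousOn_tauV θ) hz01.1 hz.2 hy.2
          (fun ξ hξ => hbd ξ ⟨hz.1.trans_lt hξ.1, hξ.2⟩)
        rw [hWgt _ _ hxr, hWle _ _ hyr, e2,
          ← intervalIntegral.integral_add_adjacent_intervals i1 i2, hzr, hv_r z ⟨hz01.1, hz1⟩,
          ← hzr, e1]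
        ring
  · intro t h1 h2
    rcases le_or_gt t r with htr | htr
    · rw [hWle _ _ htr]
      exact H.u_bc t ⟨h1.1, h1.2.1, htr⟩ ⟨h1.1, h1.2.1, htr⟩
    · rw [hWgt _ _ htr]
      exact H'.u_bc t ⟨h1.1, htr.le, h1.2.2⟩ ⟨h2.1, htr.le, h2.2.2⟩
  · intro x hx
    rw [hWle _ _ har]
    exact H.u_init x hx
  · intro x hx
    rw [hWle _ _ har]
    exact H.v_init x hx

/-- A broad solution that exists up to the characteristic of `v` starting in `(1,r)` is its own
prediction at time `r`. -/
theorem IsBound.predicts_self (h : P.IsBound K) {Du Dv : Set (ℝ × ℝ)} {t₀ r : ℝ}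
    {w₀ : ℝ → ℝ × ℝ} {w : ℝ → ℝ → ℝ × ℝ} (hw : P.IsBroadSolution Du Dv t₀ w₀ w)
    (hu : P.detU r ⊆ Du) (hv : P.detV r ⊆ Dv)
    (hc : ∀ x ∈ Icc (0 : ℝ) 1, (x, r + P.tauV x) ∈ Dv) :
    P.Predicts r (fun x => w x r) (w 1 r).2 (w 0 (r + P.tauV 0)).2 := by
  refine ⟨fun x => (w x (r + P.tauV x)).1, fun x => (w x (r + P.tauV x)).2,
    ⟨w, hw.restrict hu hv r, fun x _ => rfl⟩, ⟨?_, ?_⟩, by simp [IsBound.tauV_one], rfl⟩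
  · -- the integral equation with a bounded integrand makes `v` Lipschitz along the characteristic
    obtain ⟨C, hC⟩ := hw.bounded_u
    obtain ⟨D, hD⟩ := hw.bounded_v
    have hle : ∀ x ∈ Icc (0 : ℝ) 1, ∀ y ∈ Icc (0 : ℝ) 1, x ≤ y →
        |(w x (r + P.tauV x)).2 - (w y (r + P.tauV y)).2| ≤ K ^ 2 * max C D * (y - x) := by
      intro x hx y hy hxy
      rw [hw.v_line hxy (hc x hx) (hc y hy), add_sub_cancel_left]
      refine abs_integral_le_const hxy fun ξ hξ => ?_
      have hξ01 : ξ ∈ Icc (0 : ℝ) 1 := ⟨hx.1.trans hξ.1.le, hξ.2.le.trans hy.2⟩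
      refine (h.rateV.abs_le hξ01 _).trans (mul_le_mul_of_nonneg_left ?_ (by positivity))
      exact norm_pair_le ((hC _ (hu ⟨hξ01, by dsimp only; linarith [h.tauV_nonneg hξ01], le_rfl⟩
        : (ξ, r + P.tauV ξ) ∈ Du)).trans (le_max_left _ _))
        ((hD _ (hc ξ hξ01)).trans (le_max_right _ _))
    have hlip : LipschitzOnWith (K ^ 2 * max C D).toNNReal
        (fun x => (w x (r + P.tauV x)).2) (Icc 0 1) := by
      refine LipschitzOnWith.of_dist_le_mul fun x hx y hy => ?_
      have hcoe := Real.le_coe_toNNReal (K ^ 2 * max C D)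
      rw [Real.dist_eq, Real.dist_eq]
      rcases le_total x y with hxy | hyx
      · rw [abs_sub_comm x, abs_of_nonneg (sub_nonneg.2 hxy)]
        exact (hle x hx y hy hxy).trans (mul_le_mul_of_nonneg_right hcoe (sub_nonneg.2 hxy))
      · rw [abs_sub_comm, abs_of_nonneg (sub_nonneg.2 hyx)]
        exact (hle y hy x hx hyx).trans (mul_le_mul_of_nonneg_right hcoe (sub_nonneg.2 hyx))
    exact hlip.continuousOn
  · intro x hx y hy
    rcases le_total x y with hxy | hyx
    · have := hw.v_line hxy (hc x hx) (hc y hy)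
      change (w y _).2 = (w x _).2 - ∫ ξ in x..y, P.rhsV (w ξ (r + P.tauV ξ)) ξ
      linarith
    · have := hw.v_line hyx (hc y hy) (hc x hx)
      change (w y _).2 = (w x _).2 - ∫ ξ in x..y, P.rhsV (w ξ (r + P.tauV ξ)) ξ
      rw [intervalIntegral.integral_symm]
      linarith

end HypModel

/-! ### The closed loop -/

/-- A time before some update time, and not before the initial time, lies in one of the intervals
between update times. -/
theorem exists_between_updates {t : ℕ → EReal} (h0 : t 0 = 0) {r : EReal} (hr : 0 ≤ r) :
    ∀ k, r < t k → ∃ j, j < k ∧ t j ≤ r ∧ r < t (j + 1) := by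
  intro k
  induction k with
  | zero => intro h; exact absurd hr (not_le.2 (h0 ▸ h))
  | succ k ih =>
    intro h
    rcases le_or_gt (t k) r with hk | hk
    · exact ⟨k, k.lt_succ_self, hk, h⟩
    · obtain ⟨j, hj, h1⟩ := ih hk
      exact ⟨j, hj.trans k.lt_succ_self, h1⟩

namespace HypModel

variable {P : HypModel} {K : ℝ}

section ClosedLoop

variable {T : EReal} {ε : ℝ} {w₀ : ℝ → ℝ × ℝ} {t : ℕ → EReal} {Ubar : ℕ → ℝ} {U : ℝ → ℝ}
  {w : ℝ → ℝ → ℝ × ℝ}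

theorem IsClosedLoop.update_nonneg (H : P.IsClosedLoop T ε w₀ t Ubar U w) : ∀ k, 0 ≤ t k := by
  intro k
  induction k with
  | zero => exact H.first.ge
  | succ k ih =>
    rcases lt_or_ge (t k) T with hk | hk
    · obtain ⟨a, ha⟩ : ∃ a : ℝ, t k = a :=
        ⟨(t k).toReal, (EReal.coe_toReal (ne_top_of_lt hk)
          (ne_bot_of_le_ne_bot EReal.zero_ne_bot ih)).symm⟩
      rw [H.next k a ha (ha ▸ hk)]
      refine le_sInf ?_
      rintro _ ⟨r, hr, rfl⟩
      rw [ha] at ih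
      exact ih.trans (EReal.coe_le_coe_iff.2 hr.1)
    · rw [H.terminate k hk]; exact le_top

/-- At a time at which the trigger condition has not yet held, every continuation of the trajectory
over the determinate sets satisfies the bound `ε` at the point that is predicted. -/
theorem IsClosedLoop.abs_predicted_le (H : P.IsClosedLoop T ε w₀ t Ubar U w) (h : P.IsBound K)
    {j : ℕ} {r : ℝ} (hj : t j ≤ (r : EReal)) (hj' : (r : EReal) < t (j + 1))
    (hrT : (r : EReal) < T) {Du Dv : Set (ℝ × ℝ)} {t₀ : ℝ} {w₁ : ℝ → ℝ × ℝ} {W : ℝ → ℝ → ℝ × ℝ}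
    (HW : P.IsBroadSolution Du Dv t₀ w₁ W) (hu : P.detU r ⊆ Du) (hv : P.detV r ⊆ Dv)
    (hc : ∀ x ∈ Icc (0 : ℝ) 1, (x, r + P.tauV x) ∈ Dv) (hWw : ∀ x, W x r = w x r) :
    |(W 0 (r + P.tauV 0)).2| ≤ ε := by
  by_contra hlt
  rw [not_le] at hlt
  obtain ⟨b, hb⟩ : ∃ b : ℝ, t j = b :=
    ⟨(t j).toReal, (EReal.coe_toReal (ne_top_of_lt (hj.trans_lt (EReal.coe_lt_top r)))
      (ne_bot_of_le_ne_bot EReal.zero_ne_bot (H.update_nonneg j))).symm⟩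
  have hb0 : 0 ≤ b := by
    have := H.update_nonneg j
    rw [hb] at this
    exact_mod_cast this
  have hbr : b ≤ r := by rw [hb] at hj; exact_mod_cast hj
  have hin : ∀ s ∈ Icc b r, (w 1 s).2 = Ubar j := by
    intro s hs
    have h1 : (s : EReal) ≤ r := by exact_mod_cast hs.2
    rw [H.v_bc s (hb0.trans hs.1) (h1.trans_lt hrT)]
    exact H.hold j s (by rw [hb]; exact_mod_cast hs.1) (h1.trans_lt hj') (h1.trans_lt hrT)
  have hsub : strip b r ⊆ strip 0 r := prod_mono le_rfl (Icc_subset_Icc_left hb0)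
  have hpred := h.predicts_self HW hu hv hc
  simp only [hWw] at hpred
  rw [hin r ⟨hbr, le_rfl⟩] at hpred
  have hmem : r ∈ P.triggerTimes ε b (fun x => w x b) (Ubar j) :=
    ⟨hbr, w, _, (H.solution r (hb0.trans hbr) hrT).restrict hsub hsub b, hin, hpred, hlt⟩
  have hle : t (j + 1) ≤ r := by
    rw [H.next j b hb (hb ▸ hj.trans_lt hrT)]
    exact sInf_le ⟨r, hmem, rfl⟩
  exact absurd hj' (not_lt.2 hle)

/-- Bound of the state at the update times after the initial time. -/
def stateConst (K M ε : ℝ) : ℝ := 2 * (K * (stabConst K * M + ε) + M) * Real.exp (2 * K ^ 2)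

/-- The state at an update time is bounded independently of the number of updates and of the
elapsed time. The solution of the Cauchy problem from which the new input value is computed
continues the trajectory, so that earlier predictions refer to this continuation; hence
`|v(0,·)| ≤ ε` after time `τᵛ(0)`, and integration in the direction of increasing position
bounds the state. -/
theorem IsClosedLoop.state_bound (H : P.IsClosedLoop T ε w₀ t Ubar U w) (h : P.IsBound K)
    (hε : 0 < ε) {M : ℝ} (hM : 0 ≤ M) (hw₀ : ∀ x ∈ Icc (0 : ℝ) 1, ‖w₀ x‖ ≤ M) {k : ℕ} {a : ℝ}
    (hk : t (k + 1) = (a : EReal)) (haT : (a : EReal) < T) :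
    (∀ x ∈ Ioc (0 : ℝ) 1, |(w x a).1| ≤ stateConst K M ε) ∧
      ∀ x ∈ Ico (0 : ℝ) 1, |(w x a).2| ≤ stateConst K M ε := by
  have hK := h.pos
  have hK1 := h.one_le
  have ha : 0 ≤ a := by
    have := H.update_nonneg (k + 1)
    rw [hk] at this
    exact_mod_cast this
  obtain ⟨_, _, ⟨w', Hw', -⟩, -⟩ := H.update k a hk haT
  have HW := h.glue ha (H.solution a ha haT) Hw'
  set W : ℝ → ℝ → ℝ × ℝ := fun x s => if s ≤ a then w x s else w' x s with hW
  have hWle : ∀ x s, s ≤ a → W x s = w x s := fun x s hs => if_pos hs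
  have hS := stabConst_nonneg hK
  have h1M : ∀ x ∈ Icc (0 : ℝ) 1, |(w₀ x).1| ≤ M := fun x hx =>
    (norm_fst_le (w₀ x)).trans (hw₀ x hx)
  have h2M : ∀ x ∈ Icc (0 : ℝ) 1, |(w₀ x).2| ≤ M := fun x hx =>
    (norm_snd_le (w₀ x)).trans (hw₀ x hx)
  have hv0 : ∀ s, 0 ≤ s → s < a + P.tauV 0 → |(W 0 s).2| ≤ stabConst K * M + ε := by
    intro s hs hsa
    rcases lt_or_ge s (P.tauV 0) with hlt | hge
    · have h1 := (h.stability (a := 0) (r := 0) le_rfl (by norm_num)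
        (HW.restrict (domU_mono le_rfl ha) (domV_mono le_rfl ha) 0)
        (isBroadSolution_zero (fun _ hp => hp.1) (fun _ hp => hp.1) (fun _ hp => hp.2.1)) hM
        (fun x hx => by
          simpa [HW.u_init x hx] using h1M x (Ioc_subset_Icc_self hx))
        (fun x hx => by
          simpa [HW.v_init x hx] using h2M x (Ico_subset_Icc_self hx))
        (fun s h1 h2 => absurd h2 (not_lt.2 h1))).2 (0, s) ⟨by simp, hs, by simpa using hlt⟩
      simp only [Prod.snd_zero, sub_zero] at h1
      linarith
    · obtain ⟨r, rfl⟩ : ∃ r, s = r + P.tauV 0 := ⟨s - P.tauV 0, by ring⟩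
      have hr0 : 0 ≤ r := by linarith
      have hra : r < a := by linarith
      have hrk : (r : EReal) < t (k + 1) := by rw [hk]; exact_mod_cast hra
      obtain ⟨j, -, hj, hj'⟩ := exists_between_updates H.first (by exact_mod_cast hr0) _ hrk
      have hrT : (r : EReal) < T := (hk ▸ hrk).trans haT
      have := H.abs_predicted_le h hj hj' hrT HW (domU_mono hr0 hra.le) (domV_mono hr0 hra.le)
        (fun x hx => ⟨hx, by have := h.tauV_nonneg hx; dsimp only; linarith,
          by dsimp only; linarith⟩) (fun x => hWle x r hra.le)
      have : 0 ≤ stabConst K * M := by positivity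
      linarith
  have hev := h.space_evolution HW (Su := P.coreU 0 a) (Sv := P.domV 0 a) (fun _ hp => hp.1)
    (fun _ hp => hp) (fun _ hp => hp.1.1) (fun _ hp => hp.1)
    (A := K * (stabConst K * M + ε) + M) (by positivity) ?_ ?_
  · refine ⟨fun x hx => ?_, fun x hx => ?_⟩
    · have hx' := Ioc_subset_Icc_self hx
      rw [← hWle x a le_rfl]
      exact hev.1 (x, a) (h.mem_coreU ⟨hx', ha, by
        have := h.tauV_nonneg hx'; dsimp only; linarith⟩ hx.1)
    · have hx' := Ico_subset_Icc_self hx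
      rw [← hWle x a le_rfl]
      exact hev.2 (x, a) ⟨hx', ha, by have := h.tauV_pos hx.1 hx.2; dsimp only; linarith⟩
  · intro x θ hp
    rcases le_or_gt 0 θ with hθ | hθ
    · have hθr : θ < a + P.tauV 0 := by
        have := hp.2
        dsimp only at this
        linarith
      have m1 : ((0 : ℝ), θ) ∈ P.domU 0 a := ⟨by simp, hθ, hθr.le⟩
      have m2 : ((0 : ℝ), θ) ∈ P.domV 0 a := ⟨by simp, hθ, hθr⟩
      refine ⟨0, le_rfl, hp.1.1.1, ?_, ?_, fun ξ hξ =>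
        h.mem_of_lineU hp le_rfl (by rw [IsBound.tauU_zero]; linarith) (Ioo_subset_Ico_self hξ)⟩
        <;> rw [IsBound.tauU_zero, add_zero]
      · exact m1
      · rw [HW.u_bc θ m1 m2]
        have := (h.abs_g_le hθ _).trans (mul_le_mul_of_nonneg_left (hv0 θ hθ hθr) hK.le)
        linarith
    · obtain ⟨y, hy, hya⟩ := h.exists_tauU_eq le_rfl hp.1.1.1 hp.1.1.2
        (by rw [IsBound.tauU_zero]; linarith) hp.1.2.1
      have hy1 : 0 < y := by
        refine lt_of_le_of_ne hy.1 fun e => ?_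
        rw [← e, IsBound.tauU_zero] at hya
        linarith
      have hy' : y ∈ Ioc (0 : ℝ) 1 := ⟨hy1, hy.2.trans hp.1.1.2⟩
      refine ⟨y, hy.1, hy.2, ?_, ?_, fun ξ hξ =>
        h.mem_of_lineU hp hy.1 hya.ge (Ioo_subset_Ico_self hξ)⟩ <;> rw [hya]
      · exact ⟨Ioc_subset_Icc_self hy', le_rfl, by
          have := h.tauV_nonneg (Ioc_subset_Icc_self hy'); dsimp only; linarith⟩
      · rw [HW.u_init y hy']
        have := h1M y (Ioc_subset_Icc_self hy')
        have : 0 ≤ K * (stabConst K * M + ε) := by positivity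
        linarith
  · intro x θ hp
    have hp1 := hp.2.1
    have hp2 := hp.2.2
    have hanti := h.tauV_anti le_rfl hp.1.1 hp.1.2
    dsimp only at hp1 hp2
    have m : ((0 : ℝ), θ + P.tauV 0) ∈ P.domV 0 a :=
      ⟨by simp, by dsimp only; linarith, by dsimp only; linarith⟩
    refine ⟨m, ?_, fun ξ hξ => h.mem_of_lineV m hp.1.2 hp1 (Ioo_subset_Icc_self hξ)⟩
    have := hv0 (θ + P.tauV 0) (by linarith) (by linarith)
    have h2 : 0 ≤ stabConst K * M + ε := by positivity
    nlinarith

/-- A trajectory whose boundary values `v(0,·)` are eventually bounded by `ε` is eventually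
bounded by a multiple of `ε`. -/
theorem IsClosedLoop.norm_le_of_boundary (H : P.IsClosedLoop ⊤ ε w₀ t Ubar U w) (h : P.IsBound K)
    (hε : 0 < ε) (hv0 : ∀ s, P.tauV 0 ≤ s → |(w 0 s).2| ≤ ε) {x s : ℝ}
    (hs : P.tauV 0 + P.tauU 1 ≤ s) (hx : x ∈ Icc (0 : ℝ) 1) :
    ‖w x s‖ ≤ 2 * (K * ε) * Real.exp (2 * K ^ 2) := by
  have hK := h.pos
  have hV := h.tauV_nonneg (x := 0) (by simp)
  have hU := h.tauU_nonneg (x := 1) (by simp)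
  have Hs := H.solution (s + P.tauV 0) (by linarith) (EReal.coe_lt_top _)
  set S : Set (ℝ × ℝ) := {p | p.1 ∈ Icc (0 : ℝ) 1 ∧ P.tauV 0 + P.tauU p.1 ≤ p.2 ∧
    p.2 ≤ s + P.tauV p.1} with hS
  have hsub : S ⊆ strip 0 (s + P.tauV 0) := by
    rintro p ⟨h1, h2, h3⟩
    have := h.tauU_nonneg h1
    have := h.tauV_anti le_rfl h1.1 h1.2
    exact ⟨h1, by linarith, by linarith⟩
  have hev := h.space_evolution Hs (Su := S) (Sv := S) hsub hsub (fun _ hp => hp.1)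
    (fun _ hp => hp.1) (A := K * ε) (by positivity) ?_ ?_
  · have hmem : (x, s) ∈ S := ⟨hx, by
      have := h.tauU_mono hx.1 hx.2 le_rfl; dsimp only; linarith, by
      have := h.tauV_nonneg hx; dsimp only; linarith⟩
    exact norm_pair_le (hev.1 _ hmem) (hev.2 _ hmem)
  · rintro y θ ⟨h1, h2, h3⟩
    dsimp only at h1 h2 h3
    have hanti := h.tauV_anti le_rfl h1.1 h1.2
    have hUy := h.tauU_nonneg h1
    have m : ((0 : ℝ), θ) ∈ strip 0 (s + P.tauV 0) :=
      ⟨by simp, by dsimp only; linarith, by dsimp only; linarith⟩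
    refine ⟨0, le_rfl, h1.1, ?_, ?_, fun ξ hξ => ?_⟩
    · rw [IsBound.tauU_zero, add_zero]; exact m
    · rw [IsBound.tauU_zero, add_zero, Hs.u_bc θ m m]
      exact (h.abs_g_le (by linarith) _).trans
        (mul_le_mul_of_nonneg_left (hv0 θ (by linarith)) hK.le)
    · have g1 := h.tauU_mono hξ.1.le hξ.2.le h1.2
      have g2 := h.tauV_anti hξ.1.le hξ.2.le h1.2
      have : (ξ, θ + P.tauU ξ) ∈ S := ⟨⟨hξ.1.le, hξ.2.le.trans h1.2⟩, by dsimp only; linarith,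
        by dsimp only; linarith⟩
      exact ⟨this, this⟩
  · rintro y θ ⟨h1, h2, h3⟩
    dsimp only at h1 h2 h3
    have hanti := h.tauV_anti le_rfl h1.1 h1.2
    have hUy := h.tauU_nonneg h1
    refine ⟨⟨by simp, by dsimp only; linarith, by dsimp only; linarith⟩, ?_, fun ξ hξ => ?_⟩
    · have := hv0 (θ + P.tauV 0) (by linarith)
      nlinarith [h.one_le]
    · have g1 := h.tauU_mono hξ.1.le hξ.2.le h1.2
      have g2 := h.tauV_anti hξ.1.le hξ.2.le h1.2
      have : (ξ, θ + P.tauV ξ) ∈ S := ⟨⟨hξ.1.le, hξ.2.le.trans h1.2⟩, by dsimp only; linarith,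
        by dsimp only; linarith⟩
      exact ⟨this, this⟩

end ClosedLoop

/-! ### Dependence of the prediction on the time -/

/-- Density of the label `τᵘ - τᵛ` of the `u`-characteristics that meet a given
`v`-characteristic, extended by a constant outside of `[0,1]`. -/
def labelDensity (P : HypModel) (ξ : ℝ) : ℝ :=
  open Classical in if ξ ∈ Icc (0 : ℝ) 1 then 1 / P.lamU ξ + 1 / P.lamV ξ else 2

/-- The rate of `v` along its characteristic with respect to the label of the crossing
`u`-characteristics instead of the position, extended by zero outside of `[0,1]`. -/
def labelRate (P : HypModel) (c : ℝ × ℝ) (ξ : ℝ) : ℝ :=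
  open Classical in if ξ ∈ Icc (0 : ℝ) 1 then P.rhsV c ξ / P.labelDensity ξ else 0

theorem measurable_labelDensity (P : HypModel) : Measurable P.labelDensity :=
  Measurable.ite measurableSet_Icc
    ((measurable_const.div P.measurable_lamU).add (measurable_const.div P.measurable_lamV))
    measurable_const

namespace IsBound

theorem labelDensity_bounds (h : P.IsBound K) (ξ : ℝ) :
    1 / K ≤ P.labelDensity ξ ∧ P.labelDensity ξ ≤ 2 * K := by
  have hK := h.one_le
  have h1 : 0 < 1 / K := one_div_pos.2 h.pos
  have h2 : 1 / K ≤ 1 := (div_le_one h.pos).2 hK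
  by_cases hξ : ξ ∈ Icc (0 : ℝ) 1
  · have hu := h.invU ξ hξ
    have hv := h.invV ξ hξ
    rw [labelDensity, if_pos hξ]
    exact ⟨by linarith, by linarith⟩
  · rw [labelDensity, if_neg hξ]
    exact ⟨by linarith, by linarith⟩

theorem integral_labelDensity (h : P.IsBound K) {x : ℝ} (hx : x ∈ Icc (0 : ℝ) 1) :
    ∫ ξ in (0 : ℝ)..x, P.labelDensity ξ = P.tauU x + (P.tauV 0 - P.tauV x) := by
  have hu := (integral_inv_bounds P.measurable_lamU h.pos h.invU le_rfl hx.1 hx.2).1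
  have hv := (integral_inv_bounds P.measurable_lamV h.pos h.invV le_rfl hx.1 hx.2).1
  have hv' := (integral_inv_bounds P.measurable_lamV h.pos h.invV hx.1 hx.2 le_rfl).1
  have e : ∫ ξ in (0 : ℝ)..x, P.labelDensity ξ
      = ∫ ξ in (0 : ℝ)..x, (1 / P.lamU ξ + 1 / P.lamV ξ) := by
    refine intervalIntegral.integral_congr fun ξ hξ => ?_
    rw [uIcc_of_le hx.1] at hξ
    simp only [labelDensity, if_pos (show ξ ∈ Icc (0 : ℝ) 1 from ⟨hξ.1, hξ.2.trans hx.2⟩)]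
  rw [e, intervalIntegral.integral_add hu hv, tauU, tauV, tauV,
    ← intervalIntegral.integral_add_adjacent_intervals hv hv']
  ring

theorem labelRate_sub_le (h : P.IsBound K) (c d : ℝ × ℝ) (ξ : ℝ) :
    |P.labelRate c ξ - P.labelRate d ξ| ≤ K ^ 3 * ‖c - d‖ := by
  have hK := h.pos
  by_cases hξ : ξ ∈ Icc (0 : ℝ) 1
  · have h0 : 0 < 1 / K := one_div_pos.2 hK
    have h1 := (h.labelDensity_bounds ξ).1
    rw [labelRate, labelRate, if_pos hξ, if_pos hξ, ← sub_div, abs_div,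
      abs_of_pos (h0.trans_le h1), div_le_iff₀ (h0.trans_le h1)]
    calc |P.rhsV c ξ - P.rhsV d ξ| ≤ K ^ 2 * ‖c - d‖ := h.rateV.sub_le ξ hξ c d
      _ = K ^ 3 * ‖c - d‖ * (1 / K) := by field_simp
      _ ≤ _ := mul_le_mul_of_nonneg_left h1 (by positivity)
  · rw [labelRate, labelRate, if_neg hξ, if_neg hξ, sub_zero, abs_zero]
    positivity

theorem labelRate_zero (h : P.IsBound K) (ξ : ℝ) : P.labelRate 0 ξ = 0 := by
  by_cases hξ : ξ ∈ Icc (0 : ℝ) 1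
  · rw [labelRate, if_pos hξ, h.rateV.zero ξ hξ, zero_div]
  · rw [labelRate, if_neg hξ]

theorem abs_labelRate_le (h : P.IsBound K) (c : ℝ × ℝ) (ξ : ℝ) :
    |P.labelRate c ξ| ≤ K ^ 3 * ‖c‖ := by
  simpa [h.labelRate_zero] using h.labelRate_sub_le c 0 ξ

theorem labelDensity_mul_labelRate (h : P.IsBound K) {ξ : ℝ} (hξ : ξ ∈ Icc (0 : ℝ) 1)
    (c : ℝ × ℝ) : P.labelDensity ξ * P.labelRate c ξ = P.rhsV c ξ := by
  have h0 : 0 < 1 / K := one_div_pos.2 h.pos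
  have h1 := (h.labelDensity_bounds ξ).1
  rw [labelRate, if_pos hξ, mul_div_cancel₀ _ (h0.trans_le h1).ne']

/-- The change of the prediction by a time shift. Let `bA` and `bR` be the values of `u` along two
`v`-characteristics whose times differ by `δ`. Where they meet the same `u`-characteristic they are
close to each other, although `bA` and `bR` need not be close at the same position. In the variable
`σ = ∫₀ˣ labelDensity`, the two functions are translates of each other up to `O(δ)`, so that the
translation can be moved to the rate, which is a fixed integrable function. -/
theorem exists_shift_bound (h : P.IsBound K) {C η : ℝ} (hC : 0 ≤ C) (hη : 0 < η) :
    ∃ Δ > 0, ∀ δ, 0 ≤ δ → δ ≤ Δ → ∀ bA bR q : ℝ → ℝ,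
      AEMeasurable (fun ξ => (bA ξ, q ξ)) (volume.restrict (Icc 0 1)) →
      AEMeasurable (fun ξ => (bR ξ, q ξ)) (volume.restrict (Icc 0 1)) →
      (∀ x ∈ Ioc (0 : ℝ) 1, |bA x| ≤ C) → (∀ x ∈ Ioc (0 : ℝ) 1, |bR x| ≤ C) →
      (∀ x ∈ Ioc (0 : ℝ) 1, |q x| ≤ C) →
      (∀ y x, 0 < y → y ≤ x → x ≤ 1 → |q x - q y| ≤ C * (x - y)) →
      (∀ y x, 0 < y → y ≤ x → x ≤ 1 →
        P.tauU x - P.tauV x - (P.tauU y - P.tauV y) = δ → |bR x - bA y| ≤ C * (x - y)) →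
      ∀ x ∈ Icc (0 : ℝ) 1,
        |∫ ξ in x..1, (P.rhsV (bR ξ, q ξ) ξ - P.rhsV (bA ξ, q ξ) ξ)| ≤ η := by
  classical
  have hK := h.pos
  obtain ⟨X, hXρ, hρX, hXmono, hXlip, hXint, hXeq⟩ := exists_inverse_of_density
    P.measurable_labelDensity (one_div_pos.2 hK) (fun ξ => (h.labelDensity_bounds ξ).1)
    (fun ξ => (h.labelDensity_bounds ξ).2)
  set ρ : ℝ → ℝ := fun x => ∫ ξ in (0 : ℝ)..x, P.labelDensity ξ with hρ
  have hXρ' : ∀ x, X (ρ x) = x := hXρ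
  have hρX' : ∀ σ, ρ (X σ) = σ := hρX
  have hρ0 : ρ 0 = 0 := by simp [hρ]
  have hlt : ∀ x σ, x < X σ ↔ ρ x < σ := fun x σ => by
    rw [← hXmono.lt_iff_lt (a := ρ x), hXρ']
  have hle : ∀ x σ, X σ ≤ x ↔ σ ≤ ρ x := fun x σ => by
    rw [← hXmono.le_iff_le (b := ρ x), hXρ']
  have hge : ∀ x σ, x ≤ X σ ↔ ρ x ≤ σ := fun x σ => by
    rw [← hXmono.le_iff_le (a := ρ x), hXρ']
  have hρ1 : 0 ≤ ρ 1 := by rw [← hρ0, ← hle, hXρ']; exact zero_le_one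
  have hint : ∀ c, Integrable fun σ => P.labelRate c (X σ) := by
    intro c
    rw [hXint (fun ξ => P.labelRate c ξ)]
    have e : (fun ξ => P.labelDensity ξ * P.labelRate c ξ)
        = (Icc (0 : ℝ) 1).indicator fun ξ => P.rhsV c ξ := by
      ext ξ
      by_cases hξ : ξ ∈ Icc (0 : ℝ) 1
      · rw [indicator_of_mem hξ, h.labelDensity_mul_labelRate hξ]
      · rw [indicator_of_notMem hξ, labelRate, if_neg hξ, mul_zero]
    rw [e, integrable_indicator_iff measurableSet_Icc,
      ← intervalIntegrable_iff_integrableOn_Icc_of_le zero_le_one]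
    exact h.rateV.intervalIntegrable (c := fun _ => c) aemeasurable_const le_rfl zero_le_one le_rfl
      (fun _ _ => le_rfl)
  have hsupp : ∀ c σ, σ ∉ Icc 0 (ρ 1) → P.labelRate c (X σ) = 0 := by
    intro c σ hσ
    rw [labelRate, if_neg]
    rintro ⟨h1, h2⟩
    exact hσ ⟨by rwa [hge, hρ0] at h1, by rwa [hle] at h2⟩
  obtain ⟨Δ₀, hΔ₀, htr⟩ := exists_translate_majorant (G := fun c σ => P.labelRate c (X σ))
    (L := K ^ 3) (R := ρ 1) (C := C) (η := η / 2) (by positivity) hρ1 hint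
    (fun c d σ => h.labelRate_sub_le c d (X σ)) hsupp (by positivity)
  set E : ℝ := 2 * K ^ 3 * C + K ^ 3 * (C * K) * ρ 1 with hE
  have hE0 : 0 ≤ E := by positivity
  refine ⟨min Δ₀ (η / 2 / (E + 1)), by positivity, ?_⟩
  intro δ hδ0 hδ bA bR q hmA hmR hbA hbR hq hqlip hrel x hx
  obtain ⟨N, hNi, hNη, hN⟩ := htr δ hδ0 (hδ.trans (min_le_left _ _))
  have hδE : E * δ ≤ η / 2 := by
    have h1 := hδ.trans (min_le_right _ _)
    rw [le_div_iff₀ (by positivity)] at h1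
    nlinarith
  have hsubx : Ioc x 1 ⊆ Ioc 0 1 := Ioc_subset_Ioc_left hx.1
  -- the state along a characteristic, cut off to the part to the right of `x`
  set cut : (ℝ → ℝ) → ℝ → ℝ × ℝ := fun b ξ => if ξ ∈ Ioc x 1 then (b ξ, q ξ) else 0 with hcut
  have hcutC : ∀ b : ℝ → ℝ, (∀ x ∈ Ioc (0 : ℝ) 1, |b x| ≤ C) → ∀ ξ, ‖cut b ξ‖ ≤ C := by
    intro b hb ξ
    by_cases hξ : ξ ∈ Ioc x 1
    · simp only [hcut, if_pos hξ]
      exact norm_pair_le (hb ξ (hsubx hξ)) (hq ξ (hsubx hξ))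
    · simp only [hcut, if_neg hξ, norm_zero]
      exact hC
  have hcutint : ∀ b : ℝ → ℝ,
      AEMeasurable (fun ξ => (b ξ, q ξ)) (volume.restrict (Icc 0 1)) →
      (∀ x ∈ Ioc (0 : ℝ) 1, |b x| ≤ C) →
      IntervalIntegrable (fun ξ => P.rhsV (b ξ, q ξ) ξ) volume x 1 ∧
      Integrable (fun σ => P.labelRate (cut b (X σ)) (X σ)) ∧
      ∫ σ, P.labelRate (cut b (X σ)) (X σ) = ∫ ξ in x..1, P.rhsV (b ξ, q ξ) ξ := by
    intro b hm hb
    have e : (fun ξ => P.labelDensity ξ * P.labelRate (cut b ξ) ξ)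
        = (Ioc x 1).indicator fun ξ => P.rhsV (b ξ, q ξ) ξ := by
      ext ξ
      by_cases hξ : ξ ∈ Ioc x 1
      · rw [indicator_of_mem hξ, h.labelDensity_mul_labelRate (Ioc_subset_Icc_self (hsubx hξ))]
        simp only [hcut, if_pos hξ]
      · rw [indicator_of_notMem hξ]
        simp only [hcut, if_neg hξ, h.labelRate_zero, mul_zero]
    have hii := h.rateV.intervalIntegrable hm hx.1 hx.2 le_rfl (C := C) (fun ξ hξ =>
      norm_pair_le (hb ξ (hsubx (Ioo_subset_Ioc_self hξ))) (hq ξ (hsubx (Ioo_subset_Ioc_self hξ))))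
    refine ⟨hii, ?_, ?_⟩
    · rw [hXint (fun ξ => P.labelRate (cut b ξ) ξ), e, integrable_indicator_iff measurableSet_Ioc]
      exact (intervalIntegrable_iff_integrableOn_Ioc_of_le hx.2).1 hii
    · rw [hXeq (fun ξ => P.labelRate (cut b ξ) ξ), e, integral_indicator measurableSet_Ioc,
        intervalIntegral.integral_of_le hx.2]
  obtain ⟨iA, jA, eA⟩ := hcutint bA hmA hbA
  obtain ⟨iR, jR, eR⟩ := hcutint bR hmR hbR
  rw [intervalIntegral.integral_sub iR iA, ← eA, ← eR,
    ← integral_sub_right_eq_self (fun σ => P.labelRate (cut bA (X σ)) (X σ)) δ,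
    ← integral_sub jR (jA.comp_sub_right δ)]
  set M₁ : ℝ → ℝ := (Ioc (ρ x) (ρ x + δ)).indicator fun _ => 2 * K ^ 3 * C with hM₁
  set M₂ : ℝ → ℝ := (Ioc (ρ x) (ρ 1)).indicator fun _ => K ^ 3 * (C * K * δ) with hM₂
  have hM₁i : Integrable M₁ :=
    (integrable_indicator_iff measurableSet_Ioc).2 (integrableOn_const (by simp))
  have hM₂i : Integrable M₂ :=
    (integrable_indicator_iff measurableSet_Ioc).2 (integrableOn_const (by simp))
  have hM₁0 : ∀ σ, 0 ≤ M₁ σ := fun σ => indicator_nonneg (fun _ _ => by positivity) σ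
  have hM₂0 : ∀ σ, 0 ≤ M₂ σ := fun σ => indicator_nonneg (fun _ _ => by positivity) σ
  have hρx : ρ x ≤ ρ 1 := by rw [← hle, hXρ']; exact hx.2
  have hρx0 : 0 ≤ ρ x := by rw [← hρ0, ← hle, hXρ']; exact hx.1
  have hpt : ∀ σ, |P.labelRate (cut bR (X σ)) (X σ)
      - P.labelRate (cut bA (X (σ - δ))) (X (σ - δ))| ≤ N σ + (M₁ σ + M₂ σ) := by
    intro σ
    have h1 := hN σ (cut bA (X (σ - δ))) (hcutC bA hbA _)
    have h2 : |P.labelRate (cut bR (X σ)) (X σ) - P.labelRate (cut bA (X (σ - δ))) (X σ)|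
        ≤ M₁ σ + M₂ σ := by
      have g1 := hM₁0 σ
      have g2 := hM₂0 σ
      by_cases hσ : σ ∈ Ioc (ρ x) (ρ 1)
      · by_cases hσδ : σ ≤ ρ x + δ
        · have : M₁ σ = 2 * K ^ 3 * C := indicator_of_mem (show σ ∈ Ioc (ρ x) (ρ x + δ) from ⟨hσ.1, hσδ⟩) _
          have k1 := h.abs_labelRate_le (cut bR (X σ)) (X σ)
          have k2 := h.abs_labelRate_le (cut bA (X (σ - δ))) (X σ)
          have k3 := mul_le_mul_of_nonneg_left (hcutC bR hbR (X σ))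
            (show 0 ≤ K ^ 3 by positivity)
          have k4 := mul_le_mul_of_nonneg_left (hcutC bA hbA (X (σ - δ)))
            (show 0 ≤ K ^ 3 by positivity)
          have k5 := abs_sub (P.labelRate (cut bR (X σ)) (X σ))
            (P.labelRate (cut bA (X (σ - δ))) (X σ))
          linarith
        · rw [not_le] at hσδ
          have : M₂ σ = K ^ 3 * (C * K * δ) := indicator_of_mem hσ _
          have m1 : X σ ∈ Ioc x 1 := ⟨(hlt _ _).2 hσ.1, (hle _ _).2 hσ.2⟩
          have m2 : X (σ - δ) ∈ Ioc x 1 :=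
            ⟨(hlt _ _).2 (by linarith), (hle _ _).2 (by linarith [hσ.2])⟩
          have hXX : X (σ - δ) ≤ X σ := hXmono.monotone (by linarith)
          have hlip := hXlip (σ - δ) σ (by linarith)
          have hKδ : (σ - (σ - δ)) / (1 / K) = K * δ := by field_simp; ring
          rw [hKδ] at hlip
          have hCX : C * (X σ - X (σ - δ)) ≤ C * K * δ := by
            rw [mul_assoc]; exact mul_le_mul_of_nonneg_left hlip hC
          have hlab : P.tauU (X σ) - P.tauV (X σ) - (P.tauU (X (σ - δ)) - P.tauV (X (σ - δ)))
              = δ := by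
            have r1 := hρX' σ
            have r2 := hρX' (σ - δ)
            simp only [hρ] at r1 r2
            rw [h.integral_labelDensity (Ioc_subset_Icc_self (hsubx m1))] at r1
            rw [h.integral_labelDensity (Ioc_subset_Icc_self (hsubx m2))] at r2
            linarith
          have b1 := hrel (X (σ - δ)) (X σ) (hsubx m2).1 hXX m1.2 hlab
          have b2 := hqlip (X (σ - δ)) (X σ) (hsubx m2).1 hXX m1.2
          have hnorm : ‖cut bR (X σ) - cut bA (X (σ - δ))‖ ≤ C * K * δ := by
            simp only [hcut, if_pos m1, if_pos m2]
            exact norm_pair_le (b1.trans hCX) (b2.trans hCX)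
          have k1 := h.labelRate_sub_le (cut bR (X σ)) (cut bA (X (σ - δ))) (X σ)
          have k2 := mul_le_mul_of_nonneg_left hnorm (show 0 ≤ K ^ 3 by positivity)
          linarith
      · have z1 : cut bR (X σ) = 0 := if_neg fun hm => hσ ⟨(hlt _ _).1 hm.1, (hle _ _).1 hm.2⟩
        have z2 : P.labelRate (cut bA (X (σ - δ))) (X σ) = 0 := by
          rcases le_or_gt σ (ρ x) with hs | hs
          · have : cut bA (X (σ - δ)) = 0 := if_neg fun hm => by
              have := (hlt _ _).1 hm.1
              linarith
            rw [this, h.labelRate_zero]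
          · exact hsupp _ _ fun hm => hσ ⟨hs, hm.2⟩
        rw [z1, z2, h.labelRate_zero, sub_zero, abs_zero]
        positivity
    rw [abs_sub_comm] at h1
    exact (abs_sub_le _ (P.labelRate (cut bA (X (σ - δ))) (X σ)) _).trans (by linarith)
  have hfin := norm_integral_le_of_norm_le
    (f := fun σ => P.labelRate (cut bR (X σ)) (X σ)
      - P.labelRate (cut bA (X (σ - δ))) (X (σ - δ))) (hNi.fun_add (hM₁i.fun_add hM₂i))
    (Filter.Eventually.of_forall hpt)
  refine hfin.trans ?_
  rw [integral_add hNi (hM₁i.fun_add hM₂i), integral_add hM₁i hM₂i, hM₁, hM₂,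
    integral_indicator measurableSet_Ioc, integral_indicator measurableSet_Ioc,
    setIntegral_const, setIntegral_const, Measure.real, Measure.real, Real.volume_Ioc,
    Real.volume_Ioc, ENNReal.toReal_ofReal (by linarith), ENNReal.toReal_ofReal (by linarith),
    smul_eq_mul, smul_eq_mul]
  have e1 : (ρ 1 - ρ x) * (K ^ 3 * (C * K * δ)) ≤ ρ 1 * (K ^ 3 * (C * K * δ)) :=
    mul_le_mul_of_nonneg_right (by linarith) (by positivity)
  have e2 : E * δ = δ * (2 * K ^ 3 * C) + ρ 1 * (K ^ 3 * (C * K * δ)) := by rw [hE]; ring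
  rw [add_sub_cancel_left]
  linarith

end IsBound

/-! ### The dwell time -/

/-- Bound of a solution of the target dynamics. -/
theorem IsBound.abs_vbar_le (h : P.IsBound K) {ubar z : ℝ → ℝ} {C : ℝ} (hC : 0 ≤ C)
    (hu : ∀ x ∈ Ioc (0 : ℝ) 1, |ubar x| ≤ C) (hz : P.IsVbarSolution ubar z) (hz0 : z 0 = 0) :
    ∀ x ∈ Icc (0 : ℝ) 1, |z x| ≤ 2 * (K ^ 2 * C) * Real.exp (2 * K ^ 2) := by
  have hK := h.pos
  set k : ℝ := 2 * K ^ 2 with hk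
  have hkpos : 0 < k := by positivity
  obtain ⟨D, hD⟩ := isCompact_Icc.exists_bound_of_continuousOn hz.1
  have main := weighted_sup_bound (S := Icc (0 : ℝ) 1) (T := ∅) (φ := fun x => |z x|)
    (ψ := fun _ => 0) (ω := fun x => Real.exp (k * x)) (A := K ^ 2 * C)
    (fun _ => (Real.exp_pos _).le) ⟨|D|, fun x hx => ?_, by simp⟩ ?_ (by positivity)
  · intro x hx
    refine (main.1 x hx).trans (mul_le_mul_of_nonneg_left (Real.exp_le_exp.2 ?_) (by positivity))
    nlinarith [hx.2]
  · exact (hD x hx).trans ((le_abs_self D).trans (le_mul_of_one_le_right (abs_nonneg _)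
      (Real.one_le_exp (mul_nonneg hkpos.le hx.1))))
  · intro m hm hφ _
    refine ⟨fun x hx => ?_, by simp⟩
    have e : z x = - ∫ ξ in (0 : ℝ)..x, P.rhsV (ubar ξ, z ξ) ξ := by
      have := hz.2 0 (by simp) x hx
      rw [hz0, zero_sub] at this
      exact this
    rw [e, abs_neg]
    have hω1 : 1 ≤ Real.exp (k * x) := Real.one_le_exp (mul_nonneg hkpos.le hx.1)
    have hc : Continuous fun ξ : ℝ => K ^ 2 * (m * Real.exp (k * ξ)) := by fun_prop
    have hb := abs_integral_le_of_Ioo (F := fun ξ => P.rhsV (ubar ξ, z ξ) ξ)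
      (g := fun ξ => K ^ 2 * C + K ^ 2 * (m * Real.exp (k * ξ))) hx.1 (fun ξ hξ => by
        have hξ1 : ξ ∈ Icc (0 : ℝ) 1 := ⟨hξ.1.le, hξ.2.le.trans hx.2⟩
        have h0 : 0 ≤ m * Real.exp (k * ξ) := by positivity
        have hn : ‖(ubar ξ, z ξ)‖ ≤ C + m * Real.exp (k * ξ) :=
          norm_pair_le (by linarith [hu ξ ⟨hξ.1, hξ1.2⟩]) (by linarith [hφ ξ hξ1])
        refine (h.rateV.abs_le hξ1 _).trans
          ((mul_le_mul_of_nonneg_left hn (by positivity)).trans (le_of_eq (by ring))))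
      (intervalIntegrable_const.add (hc.intervalIntegrable _ _))
    have he := abs_integral_le_exp_left (F := fun ξ => K ^ 2 * (m * Real.exp (k * ξ))) (y := 0)
      (x := x) (k := k) (B := K ^ 2 * (m * Real.exp (k * x))) hkpos (by positivity) hx.1
      (fun ξ _ => by
        rw [abs_of_nonneg (by positivity), mul_assoc (K ^ 2), mul_assoc m, ← Real.exp_add,
          show k * x + -(k * (x - ξ)) = k * ξ by ring])
    have hek : K ^ 2 * (m * Real.exp (k * x)) / k = m / 2 * Real.exp (k * x) := by
      rw [hk]; field_simp
    rw [hek] at he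
    rw [intervalIntegral.integral_add intervalIntegrable_const (hc.intervalIntegrable _ _),
      intervalIntegral.integral_const, smul_eq_mul, sub_zero] at hb
    have h3 := le_abs_self (∫ ξ in (0 : ℝ)..x, K ^ 2 * (m * Real.exp (k * ξ)))
    have h4 : x * (K ^ 2 * C) ≤ K ^ 2 * C * Real.exp (k * x) := by
      have h0 : 0 ≤ K ^ 2 * C := by positivity
      nlinarith [hx.2]
    linarith

/-- Grönwall estimate, in the direction of decreasing position, for two solutions of the target
dynamics with the same value at `x = 1`. -/
theorem IsBound.abs_vbar_sub_le (h : P.IsBound K) {uA uR zA zR : ℝ → ℝ} {C η : ℝ} (hη : 0 ≤ η)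
    (huA : ∀ x ∈ Ioc (0 : ℝ) 1, |uA x| ≤ C) (huR : ∀ x ∈ Ioc (0 : ℝ) 1, |uR x| ≤ C)
    (hmA : AEMeasurable uA (volume.restrict (Icc 0 1)))
    (hmR : AEMeasurable uR (volume.restrict (Icc 0 1)))
    (hzA : P.IsVbarSolution uA zA) (hzR : P.IsVbarSolution uR zR) (h1 : zR 1 = zA 1)
    (hI : ∀ x ∈ Icc (0 : ℝ) 1,
      |∫ ξ in x..1, (P.rhsV (uR ξ, zA ξ) ξ - P.rhsV (uA ξ, zA ξ) ξ)| ≤ η) :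
    |zR 0 - zA 0| ≤ 2 * η * Real.exp (2 * K ^ 2) := by
  have hK := h.pos
  set k : ℝ := 2 * K ^ 2 with hk
  have hkpos : 0 < k := by positivity
  obtain ⟨DA, hDA⟩ := isCompact_Icc.exists_bound_of_continuousOn hzA.1
  obtain ⟨DR, hDR⟩ := isCompact_Icc.exists_bound_of_continuousOn hzR.1
  have main := weighted_sup_bound (S := Icc (0 : ℝ) 1) (T := ∅) (φ := fun x => |zR x - zA x|)
    (ψ := fun _ => 0) (ω := fun x => Real.exp (k * (1 - x))) (A := η)
    (fun _ => (Real.exp_pos _).le) ⟨|DA| + |DR|, fun x hx => ?_, by simp⟩ ?_ hη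
  · simpa using main.1 0 (by simp)
  · have e1 := hDA x hx
    have e2 := hDR x hx
    have e3 := abs_sub (zR x) (zA x)
    have e4 := le_abs_self DA
    have e5 := le_abs_self DR
    rw [Real.norm_eq_abs] at e1 e2
    have hω1 : 1 ≤ Real.exp (k * (1 - x)) :=
      Real.one_le_exp (mul_nonneg hkpos.le (sub_nonneg.2 hx.2))
    exact (by linarith : |zR x - zA x| ≤ |DA| + |DR|).trans
      (le_mul_of_one_le_right (by positivity) hω1)
  · intro m hm hφ _
    refine ⟨fun x hx => ?_, by simp⟩
    have eA : zA x = zA 1 + ∫ ξ in x..1, P.rhsV (uA ξ, zA ξ) ξ := by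
      have : zA 1 = zA x - ∫ ξ in x..1, P.rhsV (uA ξ, zA ξ) ξ := hzA.2 x hx 1 (by simp)
      linarith
    have eR : zR x = zR 1 + ∫ ξ in x..1, P.rhsV (uR ξ, zR ξ) ξ := by
      have : zR 1 = zR x - ∫ ξ in x..1, P.rhsV (uR ξ, zR ξ) ξ := hzR.2 x hx 1 (by simp)
      linarith
    have hint : ∀ {b z : ℝ → ℝ} {D : ℝ}, (∀ x ∈ Ioc (0 : ℝ) 1, |b x| ≤ C) →
        AEMeasurable b (volume.restrict (Icc 0 1)) → ContinuousOn z (Icc 0 1) →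
        (∀ x ∈ Icc (0 : ℝ) 1, ‖z x‖ ≤ D) →
        IntervalIntegrable (fun ξ => P.rhsV (b ξ, z ξ) ξ) volume x 1 := by
      intro b z D hb hbm hz hD
      refine h.rateV.intervalIntegrable (hbm.prodMk (hz.aemeasurable measurableSet_Icc)) hx.1 hx.2
        le_rfl (C := max C D) fun ξ hξ => ?_
      have hξ1 : ξ ∈ Ioc (0 : ℝ) 1 := ⟨hx.1.trans_lt hξ.1, hξ.2.le⟩
      exact norm_pair_le ((hb ξ hξ1).trans (le_max_left _ _))
        ((hD ξ (Ioc_subset_Icc_self hξ1)).trans (le_max_right _ _))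
    have iA := hint huA hmA hzA.1 hDA
    have iR := hint huR hmR hzR.1 hDR
    have iM := hint huR hmR hzA.1 hDA
    have hsplit : zR x - zA x
        = (∫ ξ in x..1, (P.rhsV (uR ξ, zR ξ) ξ - P.rhsV (uR ξ, zA ξ) ξ))
          + ∫ ξ in x..1, (P.rhsV (uR ξ, zA ξ) ξ - P.rhsV (uA ξ, zA ξ) ξ) := by
      rw [intervalIntegral.integral_sub iR iM, intervalIntegral.integral_sub iM iA, eA, eR, h1]
      ring
    have hb := abs_integral_le_exp_right
      (F := fun ξ => P.rhsV (uR ξ, zR ξ) ξ - P.rhsV (uR ξ, zA ξ) ξ) (y := x) (x := 1) (k := k)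
      (B := K ^ 2 * (m * Real.exp (k * (1 - x)))) hkpos (by positivity) hx.2 (fun ξ hξ => by
        have hξ1 : ξ ∈ Icc (0 : ℝ) 1 := ⟨hx.1.trans hξ.1.le, hξ.2.le⟩
        have e := h.rateV.sub_le ξ hξ1 (uR ξ, zR ξ) (uR ξ, zA ξ)
        have hn : ‖(uR ξ, zR ξ) - (uR ξ, zA ξ)‖ ≤ m * Real.exp (k * (1 - ξ)) :=
          norm_pair_le (by simp; positivity) (by simpa using hφ ξ hξ1)
        calc _ ≤ K ^ 2 * ‖(uR ξ, zR ξ) - (uR ξ, zA ξ)‖ := e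
          _ ≤ K ^ 2 * (m * Real.exp (k * (1 - ξ))) :=
            mul_le_mul_of_nonneg_left hn (by positivity)
          _ = K ^ 2 * (m * (Real.exp (k * (1 - x)) * Real.exp (-(k * (ξ - x))))) := by
            rw [← Real.exp_add]; ring_nf
          _ = _ := by ring)
    have hek : K ^ 2 * (m * Real.exp (k * (1 - x))) / k = m / 2 * Real.exp (k * (1 - x)) := by
      rw [hk]; field_simp
    rw [hek] at hb
    have hω1 : 1 ≤ Real.exp (k * (1 - x)) :=
      Real.one_le_exp (mul_nonneg hkpos.le (sub_nonneg.2 hx.2))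
    rw [hsplit]
    refine (abs_add_le _ _).trans ((add_le_add hb (hI x hx)).trans ?_)
    nlinarith

/-- After an update of the input, starting from a state bounded by `C₀`, the trigger condition
cannot hold before a time that depends only on `C₀`, on the threshold and on the model. -/
theorem IsBound.exists_dwell (h : P.IsBound K) {C₀ ε : ℝ} (hC₀ : 0 ≤ C₀) (hε : 0 < ε) :
    ∃ Δ > 0, ∀ (a : ℝ) (wa : ℝ → ℝ × ℝ) (V : ℝ), 0 ≤ a →
      (∀ x ∈ Ioc (0 : ℝ) 1, |(wa x).1| ≤ C₀) → (∀ x ∈ Ico (0 : ℝ) 1, |(wa x).2| ≤ C₀) →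
      P.IsTargetInput a wa V → ∀ r ∈ P.triggerTimes ε a wa V, a + Δ ≤ r := by
  have hK := h.pos
  have hS := stabConst_nonneg hK
  set C₁ : ℝ := stabConst K * C₀ with hC₁
  set C₂ : ℝ := 2 * (K ^ 2 * C₁) * Real.exp (2 * K ^ 2) with hC₂
  set C₃ : ℝ := stabConst K * (C₀ + C₂) with hC₃
  have hC₁0 : 0 ≤ C₁ := by positivity
  have hC₂0 : 0 ≤ C₂ := by positivity
  have hC₃0 : 0 ≤ C₃ := by positivity
  have hK2 : 1 ≤ K ^ 2 := one_le_pow₀ h.one_le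
  set C : ℝ := K ^ 2 * (C₂ + C₃) with hC
  have hC2 : C₂ ≤ C := by nlinarith
  have hC3 : C₃ ≤ C := by nlinarith
  set η : ℝ := ε / (2 * Real.exp (2 * K ^ 2)) with hη
  have hη0 : 0 < η := by positivity
  obtain ⟨Δ, hΔ, hshift⟩ := h.exists_shift_bound (C := C) (η := η) (by positivity) hη0
  refine ⟨min Δ 1, by positivity, ?_⟩
  rintro a wa V ha hwu hwv ⟨uA, zA, ⟨wA, HA, huA⟩, hzA, hzA0, hzA1⟩ r
    ⟨har, w, p, Hw, hwV, ⟨uR, zR, ⟨w', Hw', huR⟩, hzR, hzR1, hzR0⟩, hp⟩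
  by_contra hlt
  rw [not_le] at hlt
  have hδ : r - a ≤ Δ := by linarith [min_le_left Δ 1]
  have hr1 : r ≤ a + 1 := by linarith [min_le_right Δ 1]
  have HH := h.glue har Hw Hw'
  set W : ℝ → ℝ → ℝ × ℝ := fun x s => if s ≤ r then w x s else w' x s with hW
  have hWle : ∀ x s, s ≤ r → W x s = w x s := fun x s hs => if_pos hs
  have hWgt : ∀ x s, r < s → W x s = w' x s := fun x s hs => if_neg (not_le.2 hs)
  have hcurve : ∀ s ≥ a, ∀ x ∈ Ioc (0 : ℝ) 1, (x, s + P.tauV x) ∈ P.coreU a s := fun s hs x hx =>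
    h.mem_coreU ⟨Ioc_subset_Icc_self hx, by
      have := h.tauV_nonneg (Ioc_subset_Icc_self hx); dsimp only; linarith, le_rfl⟩ hx.1
  -- the two predictions are read off from the same solution `W`
  have huA' : ∀ x ∈ Ioc (0 : ℝ) 1, uA x = (W x (a + P.tauV x)).1 := by
    intro x hx
    rw [huA x (Ioc_subset_Icc_self hx)]
    have := (h.stability (a := a) (r := a) ha (by linarith) HA
      (HH.restrict (domU_mono le_rfl har) (domV_mono le_rfl har) a) le_rfl
      (fun x hx => by simp [HH.u_init x hx]) (fun x hx => by simp [HH.v_init x hx])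
      (fun s h1 h2 => absurd h2 (not_lt.2 h1))).1 _ (hcurve a le_rfl x hx)
    rw [mul_zero] at this
    exact sub_eq_zero.1 (abs_nonpos_iff.1 this)
  have huR' : ∀ x ∈ Ioc (0 : ℝ) 1, uR x = (W x (r + P.tauV x)).1 := by
    intro x hx
    rw [huR x (Ioc_subset_Icc_self hx)]
    rcases eq_or_lt_of_le hx.2 with e | hlt
    · rw [e, tauV_one, add_zero, hWle _ _ le_rfl, Hw'.u_init 1 (by simp)]
    · rw [hWgt _ _ (by have := h.tauV_pos hx.1.le hlt; linarith)]
  have huA1 : ∀ x ∈ Ioc (0 : ℝ) 1, |uA x| ≤ C₁ := by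
    intro x hx
    rw [huA x (Ioc_subset_Icc_self hx)]
    have := (h.stability (a := a) (r := a) ha (by linarith) HA
      (isBroadSolution_zero (fun _ hp => hp.1) (fun _ hp => hp.1) (fun _ hp => ha.trans hp.2.1))
      hC₀ (fun x hx => by simpa using hwu x hx) (fun x hx => by simpa using hwv x hx)
      (fun s h1 h2 => absurd h2 (not_lt.2 h1))).1 _ (hcurve a le_rfl x hx)
    simpa using this
  have hzA2 := h.abs_vbar_le hC₁0 huA1 hzA hzA0
  have hV : |V| ≤ C₂ := by rw [← hzA1]; exact hzA2 1 (by simp)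
  obtain ⟨hWu, hWv⟩ := h.stability ha hr1 HH
    (isBroadSolution_zero (fun _ hp => hp.1) (fun _ hp => hp.1) (fun _ hp => ha.trans hp.2.1))
    (B := C₀ + C₂) (by positivity)
    (fun x hx => by simpa using (hwu x hx).trans (by linarith))
    (fun x hx => by simpa using (hwv x hx).trans (by linarith))
    (fun s h1 h2 => by
      rw [hWle _ _ h2.le, hwV s ⟨h1, h2.le⟩]
      simpa using hV.trans (by linarith))
  simp only [Prod.fst_zero, Prod.snd_zero, sub_zero] at hWu hWv
  have huA3 : ∀ x ∈ Ioc (0 : ℝ) 1, |uA x| ≤ C₃ := by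
    intro x hx
    rw [huA' x hx]
    have h1 := h.tauV_nonneg (Ioc_subset_Icc_self hx)
    exact hWu (x, a + P.tauV x) (h.mem_coreU ⟨Ioc_subset_Icc_self hx, by dsimp only; linarith,
      by dsimp only; linarith⟩ hx.1)
  have huR3 : ∀ x ∈ Ioc (0 : ℝ) 1, |uR x| ≤ C₃ := by
    intro x hx
    rw [huR' x hx]
    have h1 := h.tauV_nonneg (Ioc_subset_Icc_self hx)
    exact hWu (x, r + P.tauV x) (h.mem_coreU ⟨Ioc_subset_Icc_self hx, by dsimp only; linarith,
      by dsimp only; linarith⟩ hx.1)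
  have hmA : AEMeasurable uA (volume.restrict (Icc 0 1)) := by
    refine (HA.aemeasurable_line h.continuousOn_tauV a).fst.congr ?_
    filter_upwards [ae_restrict_mem measurableSet_Icc] with ξ hξ
    exact (huA ξ hξ).symm
  have hmR : AEMeasurable uR (volume.restrict (Icc 0 1)) := by
    refine (Hw'.aemeasurable_line h.continuousOn_tauV r).fst.congr ?_
    filter_upwards [ae_restrict_mem measurableSet_Icc] with ξ hξ
    exact (huR ξ hξ).symm
  have hmz := hzA.1.aemeasurable (μ := volume) measurableSet_Icc
  have hlip : ∀ y x, 0 < y → y ≤ x → x ≤ 1 → |zA x - zA y| ≤ C * (x - y) := by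
    intro y x hy hyx hx
    have e : zA x = zA y - ∫ ξ in y..x, P.rhsV (uA ξ, zA ξ) ξ :=
      hzA.2 y ⟨hy.le, hyx.trans hx⟩ x ⟨hy.le.trans hyx, hx⟩
    rw [e, sub_sub_cancel_left, abs_neg]
    refine abs_integral_le_const hyx fun ξ hξ => ?_
    have hξ1 : ξ ∈ Ioc (0 : ℝ) 1 := ⟨hy.trans hξ.1, hξ.2.le.trans hx⟩
    refine (h.rateV.abs_le (Ioc_subset_Icc_self hξ1) _).trans
      (mul_le_mul_of_nonneg_left (norm_pair_le ?_ ?_) (by positivity))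
    · exact (huA3 ξ hξ1).trans (by linarith)
    · exact (hzA2 ξ (Ioc_subset_Icc_self hξ1)).trans (by linarith)
  have hrel : ∀ y x, 0 < y → y ≤ x → x ≤ 1 →
      P.tauU x - P.tauV x - (P.tauU y - P.tauV y) = r - a → |uR x - uA y| ≤ C * (x - y) := by
    intro y x hy hyx hx hlab
    have hx1 : x ∈ Ioc (0 : ℝ) 1 := ⟨hy.trans_le hyx, hx⟩
    have hy1 : y ∈ Ioc (0 : ℝ) 1 := ⟨hy, hyx.trans hx⟩
    obtain ⟨θ, hθ⟩ : ∃ θ, r + P.tauV x = θ + P.tauU x := ⟨r + P.tauV x - P.tauU x, by ring⟩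
    have hθy : a + P.tauV y = θ + P.tauU y := by linarith
    have hVy := h.tauV_nonneg (Ioc_subset_Icc_self hy1)
    have hVx := h.tauV_nonneg (Ioc_subset_Icc_self hx1)
    have hmx : (x, θ + P.tauU x) ∈ P.coreU a r := by
      rw [← hθ]
      exact h.mem_coreU ⟨Ioc_subset_Icc_self hx1, by dsimp only; linarith, le_rfl⟩ hx1.1
    have hmy : (y, θ + P.tauU y) ∈ P.domU a r := by
      rw [← hθy]
      exact ⟨Ioc_subset_Icc_self hy1, by dsimp only; linarith, by dsimp only; linarith⟩
    rw [huR' x hx1, huA' y hy1, hθ, hθy, HH.u_line hyx hmx.1 hmy, add_sub_cancel_left]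
    refine abs_integral_le_const hyx fun ξ hξ => ?_
    have hm := h.mem_of_lineU hmx hy.le (by linarith) (Ioo_subset_Ico_self hξ)
    refine (h.rateU.abs_le hm.2.1 _).trans
      (mul_le_mul_of_nonneg_left (norm_pair_le ?_ ?_) (by positivity))
    · exact (hWu _ hm.1).trans (by linarith)
    · exact (hWv _ hm.2).trans (by linarith)
  have hI := hshift (r - a) (by linarith) hδ uA uR zA (hmA.prodMk hmz) (hmR.prodMk hmz)
    (fun x hx => (huA3 x hx).trans hC3) (fun x hx => (huR3 x hx).trans hC3)
    (fun x hx => (hzA2 x (Ioc_subset_Icc_self hx)).trans hC2) hlip hrel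
  have hfin := h.abs_vbar_sub_le hη0.le huA3 huR3 hmA hmR hzA hzR (by rw [hzR1, hzA1]) hI
  have : 2 * η * Real.exp (2 * K ^ 2) = ε := by rw [hη]; field_simp
  rw [hzR0, hzA0, sub_zero, this] at hfin
  exact absurd hp (not_lt.2 hfin)

/-- The target input depends on the state at the corners `(0,a)`, `(1,a)` only through the
component that determines the solution there. -/
theorem IsTargetInput.congr {a V : ℝ} {w₁ w₂ : ℝ → ℝ × ℝ} (H : P.IsTargetInput a w₁ V)
    (hu : ∀ x ∈ Ioc (0 : ℝ) 1, (w₁ x).1 = (w₂ x).1)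
    (hv : ∀ x ∈ Ico (0 : ℝ) 1, (w₁ x).2 = (w₂ x).2) : P.IsTargetInput a w₂ V := by
  obtain ⟨ubar, z, ⟨w, Hw, hub⟩, hz⟩ := H
  exact ⟨ubar, z, ⟨w, { Hw with
    u_init := fun x hx => (Hw.u_init x hx).trans (hu x hx)
    v_init := fun x hx => (Hw.v_init x hx).trans (hv x hx) }, hub⟩, hz⟩

end HypModel

end

theorem theorem2 (P : HypModel) :
    ∃ c₂ : ℝ, 0 < c₂ ∧ ∀ ε : ℝ, 0 < ε →
      (∀ (w₀ : ℝ → ℝ × ℝ), Measurable w₀ → (∃ M : ℝ, ∀ x ∈ Set.Icc (0 : ℝ) 1, ‖w₀ x‖ ≤ M) →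
        ∀ (t : ℕ → EReal) (Ubar : ℕ → ℝ) (U : ℝ → ℝ) (w : ℝ → ℝ → ℝ × ℝ),
          P.IsClosedLoop ⊤ ε w₀ t Ubar U w →
            (∀ s : ℝ, P.tauV 0 ≤ s → |(w 0 s).2| ≤ ε) ∧
            (∀ s : ℝ, P.tauV 0 + P.tauU 1 ≤ s →
              ∀ x ∈ Set.Icc (0 : ℝ) 1, ‖w x s‖ ≤ c₂ * ε)) ∧
      (∀ M : ℝ, ∃ Δ : ℝ, 0 < Δ ∧
        ∀ (w₀ : ℝ → ℝ × ℝ), Measurable w₀ → (∀ x ∈ Set.Icc (0 : ℝ) 1, ‖w₀ x‖ ≤ M) →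
        ∀ (T : EReal) (t : ℕ → EReal) (Ubar : ℕ → ℝ) (U : ℝ → ℝ) (w : ℝ → ℝ → ℝ × ℝ),
          P.IsClosedLoop T ε w₀ t Ubar U w →
            ∀ k : ℕ, t k < T → (0 < k ∨ P.IsTargetInput 0 w₀ (Ubar 0)) →
              t k + (Δ : EReal) ≤ t (k + 1)) := by
  obtain ⟨K, h⟩ := P.exists_isBound
  have hK := h.pos
  refine ⟨2 * K * Real.exp (2 * K ^ 2), by positivity, fun ε hε => ?_⟩
  have hdwell : ∀ M : ℝ, ∃ Δ : ℝ, 0 < Δ ∧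
      ∀ (w₀ : ℝ → ℝ × ℝ), Measurable w₀ → (∀ x ∈ Set.Icc (0 : ℝ) 1, ‖w₀ x‖ ≤ M) →
      ∀ (T : EReal) (t : ℕ → EReal) (Ubar : ℕ → ℝ) (U : ℝ → ℝ) (w : ℝ → ℝ → ℝ × ℝ),
        P.IsClosedLoop T ε w₀ t Ubar U w →
          ∀ k : ℕ, t k < T → (0 < k ∨ P.IsTargetInput 0 w₀ (Ubar 0)) →
            t k + (Δ : EReal) ≤ t (k + 1) := by
    intro M
    have hM := abs_nonneg M
    have hS : 0 ≤ HypModel.stateConst K |M| ε := by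
      have := HypModel.stabConst_nonneg hK
      rw [HypModel.stateConst]; positivity
    obtain ⟨Δ, hΔ, hd⟩ := h.exists_dwell (C₀ := |M| + HypModel.stateConst K |M| ε) (by positivity) hε
    refine ⟨Δ, hΔ, fun w₀ _ hw₀ T t Ubar U w H k hk hor => ?_⟩
    have hw₀' : ∀ x ∈ Set.Icc (0 : ℝ) 1, ‖w₀ x‖ ≤ |M| := fun x hx =>
      (hw₀ x hx).trans (le_abs_self M)
    obtain ⟨a, ha⟩ : ∃ a : ℝ, t k = a :=
      ⟨(t k).toReal, (EReal.coe_toReal (ne_top_of_lt hk)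
        (ne_bot_of_le_ne_bot EReal.zero_ne_bot (H.update_nonneg k))).symm⟩
    have ha0 : 0 ≤ a := by
      have := H.update_nonneg k
      rw [ha] at this
      exact_mod_cast this
    have haT : (a : EReal) < T := ha ▸ hk
    have key : (∀ x ∈ Ioc (0 : ℝ) 1, |(w x a).1| ≤ |M| + HypModel.stateConst K |M| ε) ∧
        (∀ x ∈ Ico (0 : ℝ) 1, |(w x a).2| ≤ |M| + HypModel.stateConst K |M| ε) ∧
        P.IsTargetInput a (fun x => w x a) (Ubar k) := by
      rcases k with _ | k
      · have hT0 : P.IsTargetInput 0 w₀ (Ubar 0) := hor.resolve_left (lt_irrefl 0)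
        obtain rfl : a = 0 := by
          have := H.first
          rw [ha] at this
          exact_mod_cast this
        have Hs := H.solution 0 le_rfl haT
        refine ⟨fun x hx => ?_, fun x hx => ?_, hT0.congr (fun x hx => (Hs.u_init x hx).symm)
          fun x hx => (Hs.v_init x hx).symm⟩
        · have e1 := hw₀' x (Ioc_subset_Icc_self hx)
          have e2 : |(w₀ x).1| ≤ ‖w₀ x‖ := norm_fst_le (w₀ x)
          rw [Hs.u_init x hx]
          linarith
        · have e1 := hw₀' x (Ico_subset_Icc_self hx)
          have e2 : |(w₀ x).2| ≤ ‖w₀ x‖ := norm_snd_le (w₀ x)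
          rw [Hs.v_init x hx]
          linarith
      · obtain ⟨b1, b2⟩ := H.state_bound h hε hM hw₀' ha haT
        exact ⟨fun x hx => (b1 x hx).trans (by linarith), fun x hx => (b2 x hx).trans (by linarith),
          H.update k a ha haT⟩
    rw [H.next k a ha haT, ha]
    refine le_sInf ?_
    rintro _ ⟨r, hr, rfl⟩
    have := hd a (fun x => w x a) (Ubar k) ha0 key.1 key.2.1 key.2.2 r hr
    change (a : EReal) + (Δ : EReal) ≤ (r : EReal)
    exact_mod_cast this
  refine ⟨?_, hdwell⟩
  rintro w₀ hm ⟨M, hM⟩ t Ubar U w H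
  obtain ⟨Δ, hΔ, hd⟩ := hdwell M
  -- the update times exceed every bound, because their distances are bounded from below
  have hgrow : ∀ k : ℕ, ((k * Δ : ℝ) : EReal) ≤ t (k + 1) := by
    intro k
    induction k with
    | zero => simpa using H.update_nonneg 1
    | succ k ih =>
      rcases lt_or_ge (t (k + 1)) ⊤ with hlt | hge
      · have h1 := hd w₀ hm hM ⊤ t Ubar U w H (k + 1) hlt (Or.inl k.succ_pos)
        refine le_trans ?_ h1
        have e : (((k + 1 : ℕ) * Δ : ℝ) : EReal) = ((k * Δ : ℝ) : EReal) + (Δ : EReal) := by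
          rw [← EReal.coe_add]
          congr 1
          push_cast
          ring
        rw [e]
        exact add_le_add_left ih _
      · rw [H.terminate (k + 1) hge]; exact le_top
  have hbd : ∀ s : ℝ, P.tauV 0 ≤ s → |(w 0 s).2| ≤ ε := by
    intro s hs
    obtain ⟨r, rfl⟩ : ∃ r, s = r + P.tauV 0 := ⟨s - P.tauV 0, by ring⟩
    have hr0 : 0 ≤ r := by linarith
    obtain ⟨n, hn⟩ := exists_nat_gt (r / Δ)
    have hrn : (r : EReal) < t (n + 1) := by
      rw [div_lt_iff₀ hΔ] at hn
      exact lt_of_lt_of_le (by exact_mod_cast hn) (hgrow n)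
    obtain ⟨j, -, hj, hj'⟩ := exists_between_updates H.first (by exact_mod_cast hr0) _ hrn
    have hsub : ∀ x ∈ Icc (0 : ℝ) 1, P.tauV x ≤ P.tauV 0 := fun x hx =>
      h.tauV_anti le_rfl hx.1 hx.2
    exact H.abs_predicted_le h hj hj' (EReal.coe_lt_top r)
      (H.solution (r + P.tauV 0) (by linarith [h.tauV_nonneg (x := 0) (by simp)])
        (EReal.coe_lt_top _))
      (fun p hp => ⟨hp.1, hr0.trans hp.2.1, hp.2.2.trans (by linarith [hsub p.1 hp.1])⟩)
      (fun p hp => ⟨hp.1, hr0.trans hp.2.1, hp.2.2.le.trans (by linarith [hsub p.1 hp.1])⟩)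
      (fun x hx => ⟨hx, by have := h.tauV_nonneg hx; dsimp only; linarith,
        by have := hsub x hx; dsimp only; linarith⟩) (fun _ => rfl)
  refine ⟨hbd, fun s hs x hx => (H.norm_le_of_boundary h hε hbd hs hx).trans (le_of_eq ?_)⟩
  ring
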